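/- A (right) pre-Lie algebra is a vector space with a bilinear product $\curvearrowleft$ such that $(x\curvearrowleft y)\curvearrowleft z-x\curvearrowleft(y\curvearrowleft z)=(x\curvearrowleft z)\curvearrowleft y-x\curvearrowleft(z\curvearrowleft y)$. For a field $K\supseteq\mathbb{Q}$ let $\mathsf{PL}_K=\bigoplus_{n\ge1}\mathsf{PL}_{K,n}$ be the free pre-Lie algebra over $K$ on one generator $\bullet$ (equivalently, the space spanned by rooted trees, with the grafting product), graded so that $\bullet$ has degree $1$, and let $\widehat{\mathsf{PL}}_K=\prod_{n\ge1}\mathsf{PL}_{K,n}$ be its completion. For $A,T\in\widehat{\mathsf{PL}}_K$ and a formal power series $f(x)=\sum_{k\ge0}f_kx^k$ over $K$ put $A\curvearrowleft f(T)=\sum_{k\ge0}f_k\,((A\curvearrowleft T)\curvearrowleft\cdots)\curvearrowleft T$ ($k$ copies of $T$ in the $k$-th term), and for $A=\sum_n A_n$ put $A[q]=\sum_{n\ge1}q^nA_n$. There is a unique $\Omega\in\widehat{\mathsf{PL}}_{\mathbb{Q}}$ with $$\bullet\curvearrowleft\frac{\Omega}{\exp(\Omega)-1}=\Omega,$$ and,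 $q$ being an indeterminate, there is a unique $\Omega_q=\sum_{n\ge1}\Omega_{q,n}\in\widehat{\mathsf{PL}}_{\mathbb{Q}(q)}$ with $$\Omega_q[q]\curvearrowleft(\exp(\Omega)-1)+\Omega_q[q]-\Omega_q=\bullet\curvearrowleft\Omega_q+(q-1)\,\bullet .$$ Let $\operatorname{Dend}$ be the free dendriform algebra over $\mathbb{Q}(q)$ on one generator. Its basis consists of the planar binary trees with at least one vertex. Write $l\vee r$ for the tree with left subtree $l$ and right subtree $r$, each possibly empty; the products are $(l\vee r)\prec s=l\vee(r*s)$ and $t\succ(l\vee r)=(t*l)\vee r$, where $*$ is $\prec+\succ$ and the empty tree is the unit for $*$. Let $\phi:\mathsf{PL}_{\mathbb{Q}(q)}\to\operatorname{Dend}$ be the unique morphism of pre-Lie algebras, for the pre-Lie product $x\curvearrowleft y=y\succ x-x\prec y$ on $\operatorname{Dend}$, that sends $\bullet$ to the planar binary tree with one vertex. Label the leaves of a planar binary tree $t$ with $n$ vertices by $0,1,\dots,n$ from left to right. A descent of $t$ is a label $i$ with $0<i<n$ such that the leaf $i$ is a left child (that is, is oriented like $\backslash$, with the root drawn at the bottom).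 Let $d(t)$ be the number of descents of $t$ and $\operatorname{maj}(t)$ their sum. Let $[n]_q=1+q+\dots+q^{n-1}$, $[n]_q!=[1]_q\cdots[n]_q$ and $\binom{n}{k}_q=\frac{[n]_q!}{[k]_q!\,[n-k]_q!}$. Then for every $n\ge1$ $$\phi(\Omega_{q,n})=\frac{(-1)^{n-1}}{[n]_q}\sum_{\#t=n}(-1)^{d(t)}\binom{n-1}{d(t)}_q^{-1}q^{\operatorname{maj}(t)-\binom{d(t)+1}{2}}\;t,$$ where the sum runs over all planar binary trees $t$ with $n$ vertices. -/

import Mathlib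

noncomputable section

/-! ### Free pre-Lie algebras

Pre-Lie algebras are right pre-Lie algebras (`RightPreLieRing`, `RightPreLieAlgebra`); the pre-Lie
product `x ↶ y` is written `x * y`. -/

namespace FreePreLie

/-- The relation on the free non-associative algebra imposing the right pre-Lie identity
`(a b) c - a (b c) = (a c) b - a (c b)`. -/
inductive Rel (R X : Type*) [CommRing R] :
    FreeNonUnitalNonAssocAlgebra R X → FreeNonUnitalNonAssocAlgebra R X → Prop
  | preLie (a b c : FreeNonUnitalNonAssocAlgebra R X) :
      Rel R X (a * b * c - a * (b * c)) (a * c * b - a * (c * b))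
  | smul (t : R) {a b : FreeNonUnitalNonAssocAlgebra R X} : Rel R X a b → Rel R X (t • a) (t • b)
  | add_right {a b : FreeNonUnitalNonAssocAlgebra R X} (c : FreeNonUnitalNonAssocAlgebra R X) :
      Rel R X a b → Rel R X (a + c) (b + c)
  | mul_left (a : FreeNonUnitalNonAssocAlgebra R X) {b c : FreeNonUnitalNonAssocAlgebra R X} :
      Rel R X b c → Rel R X (a * b) (a * c)
  | mul_right {a b : FreeNonUnitalNonAssocAlgebra R X} (c : FreeNonUnitalNonAssocAlgebra R X) :
      Rel R X a b → Rel R X (a * c) (b * c)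

end FreePreLie

/-- The free (right) pre-Lie algebra over `R` on the set `X`: the quotient of the free
non-associative algebra by the pre-Lie identity. -/
def FreePreLie (R X : Type*) [CommRing R] : Type _ := Quot (FreePreLie.Rel R X)

namespace FreePreLie

section

variable {R X : Type*} [CommRing R]

theorem Rel.addLeft (a : FreeNonUnitalNonAssocAlgebra R X)
    {b c : FreeNonUnitalNonAssocAlgebra R X} (h : Rel R X b c) : Rel R X (a + b) (a + c) := by
  rw [add_comm _ b, add_comm _ c]; exact h.add_right _

theorem Rel.neg {a b : FreeNonUnitalNonAssocAlgebra R X} (h : Rel R X a b) :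
    Rel R X (-a) (-b) := by
  simpa only [neg_one_smul] using h.smul (-1)

theorem Rel.subLeft (a : FreeNonUnitalNonAssocAlgebra R X)
    {b c : FreeNonUnitalNonAssocAlgebra R X} (h : Rel R X b c) : Rel R X (a - b) (a - c) := by
  simpa only [sub_eq_add_neg] using h.neg.addLeft a

theorem Rel.subRight {a b : FreeNonUnitalNonAssocAlgebra R X}
    (c : FreeNonUnitalNonAssocAlgebra R X) (h : Rel R X a b) : Rel R X (a - c) (b - c) := by
  simpa only [sub_eq_add_neg] using h.add_right (-c)

theorem Rel.smulOfTower {S : Type*} [Monoid S] [DistribMulAction S R] [IsScalarTower S R R] (t : S)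
    (a b : FreeNonUnitalNonAssocAlgebra R X) (h : Rel R X a b) : Rel R X (t • a) (t • b) := by
  rw [← smul_one_smul R t a, ← smul_one_smul R t b]
  exact h.smul _

instance {S : Type*} [Monoid S] [DistribMulAction S R] [IsScalarTower S R R] :
    SMul S (FreePreLie R X) where
  smul t := Quot.map (t • ·) (Rel.smulOfTower t)

instance : Zero (FreePreLie R X) where zero := Quot.mk _ 0

instance : Add (FreePreLie R X) where
  add := Quot.map₂ (· + ·) (fun _ _ _ => Rel.addLeft _) fun _ _ _ => Rel.add_right _

instance : Neg (FreePreLie R X) where neg := Quot.map Neg.neg fun _ _ => Rel.neg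

instance : Sub (FreePreLie R X) where
  sub := Quot.map₂ Sub.sub (fun _ _ _ => Rel.subLeft _) fun _ _ _ => Rel.subRight _

instance : Mul (FreePreLie R X) where
  mul := Quot.map₂ (· * ·) (fun _ _ _ => Rel.mul_left _) fun _ _ _ => Rel.mul_right _

instance : AddGroup (FreePreLie R X) :=
  Function.Surjective.addGroup (Quot.mk _) Quot.mk_surjective rfl (fun _ _ => rfl)
    (fun _ => rfl) (fun _ _ => rfl) (fun _ _ => rfl) fun _ _ => rfl

instance : AddCommGroup (FreePreLie R X) where
  add_comm := by
    rintro ⟨a⟩ ⟨b⟩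
    exact congrArg (Quot.mk (Rel R X)) (add_comm a b)

instance : RightPreLieRing (FreePreLie R X) where
  left_distrib := by
    rintro ⟨a⟩ ⟨b⟩ ⟨c⟩
    exact congrArg (Quot.mk (Rel R X)) (mul_add a b c)
  right_distrib := by
    rintro ⟨a⟩ ⟨b⟩ ⟨c⟩
    exact congrArg (Quot.mk (Rel R X)) (add_mul a b c)
  zero_mul := by
    rintro ⟨a⟩
    exact congrArg (Quot.mk (Rel R X)) (zero_mul a)
  mul_zero := by
    rintro ⟨a⟩
    exact congrArg (Quot.mk (Rel R X)) (mul_zero a)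
  assoc_symm' := by
    rintro ⟨a⟩ ⟨b⟩ ⟨c⟩
    exact Quot.sound (Rel.preLie a b c)

/-- `FreePreLie R X` is a pre-Lie algebra over `R`, and over every ring `S` of which `R` is an
algebra. -/
instance {S : Type*} [CommRing S] [Algebra S R] : RightPreLieAlgebra S (FreePreLie R X) where
  one_smul := by
    rintro ⟨a⟩
    exact congrArg (Quot.mk (Rel R X)) (one_smul S a)
  mul_smul := by
    rintro s t ⟨a⟩
    exact congrArg (Quot.mk (Rel R X)) (mul_smul s t a)
  smul_zero := fun s => congrArg (Quot.mk (Rel R X)) (smul_zero s)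
  smul_add := by
    rintro s ⟨a⟩ ⟨b⟩
    exact congrArg (Quot.mk (Rel R X)) (smul_add s a b)
  add_smul := by
    rintro s t ⟨a⟩
    exact congrArg (Quot.mk (Rel R X)) (add_smul s t a)
  zero_smul := by
    rintro ⟨a⟩
    exact congrArg (Quot.mk (Rel R X)) (zero_smul S a)
  smul_assoc := by
    rintro s ⟨a⟩ ⟨b⟩
    exact congrArg (Quot.mk (Rel R X)) (smul_mul_assoc s a b)
  smul_comm := by
    rintro s ⟨a⟩ ⟨b⟩
    exact congrArg (Quot.mk (Rel R X)) (mul_smul_comm s a b).symm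

variable (R) in
/-- The generators of the free pre-Lie algebra. -/
def of (x : X) : FreePreLie R X := Quot.mk _ (FreeNonUnitalNonAssocAlgebra.of R x)

variable (R) in
theorem lift_rel {A : Type*} [RightPreLieRing A] [RightPreLieAlgebra R A] (f : X → A)
    (a b : FreeNonUnitalNonAssocAlgebra R X) (h : Rel R X a b) :
    FreeNonUnitalNonAssocAlgebra.lift R f a = FreeNonUnitalNonAssocAlgebra.lift R f b := by
  induction h with
  | preLie a b c =>
    simpa only [map_sub, map_mul, associator_apply] using RightPreLieRing.assoc_symm
      (FreeNonUnitalNonAssocAlgebra.lift R f a) (FreeNonUnitalNonAssocAlgebra.lift R f b)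
      (FreeNonUnitalNonAssocAlgebra.lift R f c)
  | smul t _ ih => simp only [map_smul, ih]
  | add_right c _ ih => simp only [map_add, ih]
  | mul_left c _ ih => simp only [map_mul, ih]
  | mul_right c _ ih => simp only [map_mul, ih]

variable (R) in
/-- The unique morphism of pre-Lie algebras out of the free one with given values on the
generators. -/
def lift {A : Type*} [RightPreLieRing A] [RightPreLieAlgebra R A] (f : X → A) :
    FreePreLie R X →ₙₐ[R] A where
  toFun c := Quot.liftOn c (FreeNonUnitalNonAssocAlgebra.lift R f) (lift_rel R f)
  map_smul' := by
    rintro t ⟨a⟩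
    exact map_smul (FreeNonUnitalNonAssocAlgebra.lift R f) t a
  map_zero' := map_zero (FreeNonUnitalNonAssocAlgebra.lift R f)
  map_add' := by
    rintro ⟨a⟩ ⟨b⟩
    exact map_add (FreeNonUnitalNonAssocAlgebra.lift R f) a b
  map_mul' := by
    rintro ⟨a⟩ ⟨b⟩
    exact map_mul (FreeNonUnitalNonAssocAlgebra.lift R f) a b

theorem lift_of {A : Type*} [RightPreLieRing A] [RightPreLieAlgebra R A] (f : X → A) (x : X) :
    lift R f (of R x) = f x :=
  FreeNonUnitalNonAssocAlgebra.lift_of_apply R f x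

theorem lift_unique {A : Type*} [RightPreLieRing A] [RightPreLieAlgebra R A] (f : X → A)
    (g : FreePreLie R X →ₙₐ[R] A) (hg : ∀ x, g (of R x) = f x) : g = lift R f := by
  let m : FreeNonUnitalNonAssocAlgebra R X →ₙₐ[R] FreePreLie R X :=
    { toFun := Quot.mk (Rel R X)
      map_smul' := fun _ _ => rfl
      map_zero' := rfl
      map_add' := fun _ _ => rfl
      map_mul' := fun _ _ => rfl }
  have h : g.comp m = FreeNonUnitalNonAssocAlgebra.lift R f := by
    apply FreeNonUnitalNonAssocAlgebra.hom_ext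
    intro x
    exact (hg x).trans (FreeNonUnitalNonAssocAlgebra.lift_of_apply R f x).symm
  ext c
  obtain ⟨a, rfl⟩ := Quot.mk_surjective c
  exact DFunLike.congr_fun h a

end

end FreePreLie

/-! ### The free pre-Lie algebra on one generator and its completion -/

/-- The free pre-Lie algebra on one generator. -/
abbrev PL (R : Type*) [CommRing R] : Type _ := FreePreLie R Unit

namespace PL

variable (R : Type*) [CommRing R]

/-- The homogeneous component of degree `n` of `PL`: the span of the monomials (products, with any
bracketing, of copies of the generator) with `n` factors. -/
def homog (n : ℕ) : Submodule R (PL R) :=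
  Submodule.span R (FreeMagma.lift (FreePreLie.of R (X := Unit)) '' {w | w.length = n})

theorem of_mem_homog : FreePreLie.of R () ∈ homog R 1 :=
  Submodule.subset_span ⟨FreeMagma.of (), rfl, FreeMagma.lift_of _ _⟩

variable {R}

theorem mul_mem_homog {m n : ℕ} {x y : PL R} (hx : x ∈ homog R m) (hy : y ∈ homog R n) :
    x * y ∈ homog R (m + n) := by
  induction hx using Submodule.span_induction with
  | zero => rw [zero_mul]; exact Submodule.zero_mem _
  | add a b _ _ ha hb => rw [add_mul]; exact Submodule.add_mem _ ha hb
  | smul c a _ ha => rw [smul_mul_assoc]; exact Submodule.smul_mem _ _ ha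
  | mem a ha =>
    obtain ⟨v, hv, rfl⟩ := ha
    induction hy using Submodule.span_induction with
    | zero => rw [mul_zero]; exact Submodule.zero_mem _
    | add a b _ _ ha hb => rw [mul_add]; exact Submodule.add_mem _ ha hb
    | smul c a _ ha => rw [mul_smul_comm]; exact Submodule.smul_mem _ _ ha
    | mem b hb =>
      obtain ⟨w, hw, rfl⟩ := hb
      refine Submodule.subset_span ⟨v * w, ?_, map_mul _ v w⟩
      change v.length + w.length = m + n
      rw [hv, hw]

variable (R) in
/-- Extension of scalars from `ℚ` to `R`, the morphism preserving the generator. -/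
def extend [Algebra ℚ R] : PL ℚ →ₙₐ[ℚ] PL R := FreePreLie.lift ℚ (FreePreLie.of R)

theorem extend_mem_homog [Algebra ℚ R] {n : ℕ} {x : PL ℚ} (hx : x ∈ homog ℚ n) :
    extend R x ∈ homog R n := by
  induction hx using Submodule.span_induction with
  | zero => rw [map_zero]; exact Submodule.zero_mem _
  | add a b _ _ ha hb => rw [map_add]; exact Submodule.add_mem _ ha hb
  | smul c a _ ha =>
    have h : extend R (c • a) = algebraMap ℚ R c • extend R a := by
      rw [map_smul]
      generalize extend R a = z
      obtain ⟨z, rfl⟩ := Quot.mk_surjective z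
      exact congrArg (Quot.mk _) (algebraMap_smul R c z).symm
    rw [h]
    exact Submodule.smul_mem _ _ ha
  | mem a ha =>
    obtain ⟨w, hw, rfl⟩ := ha
    refine Submodule.subset_span ⟨w, hw, ?_⟩
    clear hw
    induction w with
    | ih1 x => exact (FreePreLie.lift_of (R := ℚ) (FreePreLie.of R) x).symm
    | ih2 v w hv hw => rw [map_mul, map_mul, map_mul, hv, hw]

end PL

/-- The completion `∏ₙ PLₙ` of `PL`; the component of degree `0` is zero. -/
abbrev PLHat (R : Type*) [CommRing R] : Type _ := (n : ℕ) → PL.homog R n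

namespace PLHat

variable {R : Type*} [CommRing R]

variable (R) in
/-- The generator, as an element of the completion. -/
def gen : PLHat R := Pi.single 1 ⟨FreePreLie.of R (), PL.of_mem_homog R⟩

/-- The pre-Lie product `A ↶ B` on the completion. -/
def graft (A B : PLHat R) : PLHat R := fun n =>
  ⟨∑ p ∈ Finset.HasAntidiagonal.antidiagonal n, (A p.1 : PL R) * (B p.2 : PL R), Submodule.sum_mem _ fun p hp => by
    rw [← Finset.HasAntidiagonal.mem_antidiagonal.mp hp]
    exact PL.mul_mem_homog (A p.1).2 (B p.2).2⟩

/-- The right action `A ↶ f(T)` on the completion of the element `f(T) = ∑ₖ fₖ T⋆ᵏ` of the completed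
enveloping algebra, where `A ↶ T⋆ᵏ = ((A ↶ T) ↶ ⋯) ↶ T`. In degree `n` the terms with `k > n`
vanish, because `T` has no component of degree `0`. -/
def act (A : PLHat R) (f : PowerSeries R) (T : PLHat R) : PLHat R := fun n =>
  ∑ k ∈ Finset.range (n + 1), PowerSeries.coeff k f • ((fun B => graft B T)^[k] A) n

/-- The `q`-shift `A[q] = ∑ₙ qⁿ Aₙ`. -/
def qShift (q : R) (A : PLHat R) : PLHat R := fun n => q ^ n • A n

variable (R) in
/-- Extension of scalars from `ℚ` to `R`. -/
def extend [Algebra ℚ R] (A : PLHat ℚ) : PLHat R := fun n =>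
  ⟨PL.extend R (A n : PL ℚ), PL.extend_mem_homog (A n).2⟩

end PLHat

open PLHat in
/-- The equation `• ↶ (Ω / (exp Ω - 1)) = Ω` defining `Ω`; here `bernoulliPowerSeries` is
`x / (exp x - 1) = ∑ₖ Bₖ xᵏ / k!`. -/
def IsOmega (Ω : PLHat ℚ) : Prop :=
  act (gen ℚ) (bernoulliPowerSeries ℚ) Ω = Ω

open PLHat in
/-- The equation `Ω_q[q] ↶ (exp Ω - 1) + Ω_q[q] - Ω_q = • ↶ Ω_q + (q - 1) •` defining `Ω_q`, over a
field `K` of characteristic zero with a parameter `q`. -/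
def IsOmegaQ {K : Type*} [Field K] [Algebra ℚ K] (q : K) (Ω : PLHat ℚ) (Ωq : PLHat K) : Prop :=
  act (qShift q Ωq) (PowerSeries.exp K - 1) (extend K Ω) + qShift q Ωq - Ωq
    = graft (gen K) Ωq + (q - 1) • gen K

/-! ### The free dendriform algebra on one generator -/

/-- The non-empty planar binary trees: the tree `left ∨ right` has a root vertex and the (possibly
empty) left and right subtrees. -/
@[ext]
structure PBT where
  left : BinaryTree Unit
  right : BinaryTree Unit

namespace PBT

/-- The underlying binary tree, in which `BinaryTree.nil` stands for a leaf. -/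
def toTree (t : PBT) : BinaryTree Unit := .node () t.left t.right

theorem toTree_injective : Function.Injective toTree := by
  rintro ⟨a, b⟩ ⟨c, d⟩ h
  simpa [toTree] using h

/-- The number of (inner) vertices. -/
def deg (t : PBT) : ℕ := t.toTree.numNodes

/-- The finite set of planar binary trees with `n` vertices, for `n ≥ 1`. -/
def ofDeg (n : ℕ) : Finset PBT :=
  (BinaryTree.treesOfNumNodesEq n).preimage toTree toTree_injective.injOn

theorem mem_ofDeg {n : ℕ} {t : PBT} : t ∈ ofDeg n ↔ t.deg = n := by
  simp [ofDeg, deg]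

/-- The orientations of the leaves from left to right, `true` for a leaf that is a left child
(oriented `\`, the root being at the bottom) and `false` for a leaf that is a right child (oriented
`/`). The second argument says whether the tree itself hangs as a left child. -/
def leafSides : BinaryTree Unit → Bool → List Bool
  | .nil, b => [b]
  | .node _ l r, _ => leafSides l true ++ leafSides r false

/-- The orientations of the leaves `0, …, n` of a planar binary tree with `n` vertices. -/
def leaves (t : PBT) : List Bool := leafSides t.left true ++ leafSides t.right false

/-- The descent set: the labels of the `\`-oriented inner leaves. -/
def descents (t : PBT) : Finset ℕ :=
  (Finset.Ioo 0 t.deg).filter fun i => t.leaves[i]? = some true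

/-- The number of descents. -/
def d (t : PBT) : ℕ := t.descents.card

/-- The major index, the sum of the descents. -/
def maj (t : PBT) : ℕ := ∑ i ∈ t.descents, i

/-- The terms of the associative product `t * s` of two possibly empty planar binary trees; the empty
tree is the unit, and `t * s = l ∨ (r * s) + (t * l') ∨ r'` for `t = l ∨ r` and `s = l' ∨ r'`. -/
def star : BinaryTree Unit → BinaryTree Unit → Multiset (BinaryTree Unit)
  | .nil, s => {s}
  | .node _ l r, .nil => {.node () l r}
  | .node _ l r, .node _ l' r' =>
      (star r (.node () l' r')).map (fun u => .node () l u) +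
      (star (.node () l r) l').map (fun u => .node () u r')
termination_by t s => t.numNodes + s.numNodes
decreasing_by all_goals simp [BinaryTree.numNodes]; try omega

/-- The terms of `t ≺ s = l ∨ (r * s)` for `t = l ∨ r`. -/
def prec (t s : PBT) : Multiset PBT := (star t.right s.toTree).map fun u => ⟨t.left, u⟩

/-- The terms of `t ≻ s = (t * l) ∨ r` for `s = l ∨ r`. -/
def succ (t s : PBT) : Multiset PBT := (star t.toTree s.left).map fun u => ⟨u, s.right⟩

theorem star_nil_right (t : BinaryTree Unit) : star t .nil = {t} := by
  cases t <;> simp [star]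

theorem star_nil_left (t : BinaryTree Unit) : star .nil t = {t} := by
  simp [star]

theorem star_toTree (t s : PBT) :
    star t.toTree s.toTree = (prec t s).map toTree + (succ t s).map toTree := by
  simp only [toTree, prec, succ, Multiset.map_map, Function.comp_def]
  rw [star]

theorem star_node (a b c e : BinaryTree Unit) :
    star (.node () a b) (.node () c e) =
      (star b (.node () c e)).map (fun u => .node () a u) +
      (star (.node () a b) c).map (fun u => .node () u e) := by
  rw [star]

theorem star_assoc (x y z : BinaryTree Unit) :
    (star x y).bind (fun w => star w z) = (star y z).bind (fun w => star x w) := by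
  match x, y, z with
  | .nil, y, z =>
    have h := Multiset.bind_singleton (star y z) id
    simp only [id, Multiset.map_id'] at h
    simp [star_nil_left, h]
  | x, .nil, z => simp [star_nil_left, star_nil_right]
  | x, y, .nil =>
    have h := Multiset.bind_singleton (star x y) id
    simp only [id, Multiset.map_id'] at h
    simp [star_nil_right, h]
  | .node () a b, .node () c e, .node () f g =>
    have h1 := congrArg (Multiset.map fun u => BinaryTree.node () a u)
      (star_assoc b (.node () c e) (.node () f g))
    have h2 := congrArg (Multiset.map fun u => BinaryTree.node () u g)
      (star_assoc (.node () a b) (.node () c e) f)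
    have h3 := Multiset.bind_map_comm (star (.node () a b) c) (star e (.node () f g))
      (f := fun w v => BinaryTree.node () w v)
    rw [star_node c e] at h1
    rw [star_node a b] at h2
    simp only [Multiset.add_bind, Multiset.bind_map, Multiset.map_add, Multiset.map_bind] at h1 h2
    rw [star_node a b c e, star_node c e f g]
    simp only [Multiset.add_bind, Multiset.bind_map, star_node, Multiset.bind_add]
    rw [h1, h3, ← h2]
    abel
termination_by x.numNodes + y.numNodes + z.numNodes
decreasing_by all_goals simp [BinaryTree.numNodes]; try omega

theorem prec_prec (x y z : PBT) :
    (prec x y).bind (fun w => prec w z) = (prec y z + succ y z).bind (fun w => prec x w) := by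
  have h := congrArg (Multiset.map fun u => PBT.mk x.left u) (star_assoc x.right y.toTree z.toTree)
  rw [star_toTree y z, ← Multiset.map_add] at h
  simp only [Multiset.map_bind, Multiset.bind_map] at h
  simp only [prec, Multiset.bind_map] at h ⊢
  exact h

theorem succ_prec (x y z : PBT) :
    (succ x y).bind (fun w => prec w z) = (prec y z).bind (fun w => succ x w) := by
  simp only [prec, succ, Multiset.bind_map]
  exact Multiset.bind_map_comm _ _

theorem succ_succ (x y z : PBT) :
    (prec x y + succ x y).bind (fun w => succ w z) = (succ y z).bind (fun w => succ x w) := by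
  have h := congrArg (Multiset.map fun u => PBT.mk u z.right) (star_assoc x.toTree y.toTree z.left)
  rw [star_toTree x y, ← Multiset.map_add] at h
  simp only [Multiset.map_bind, Multiset.bind_map] at h
  simp only [succ, Multiset.bind_map] at h ⊢
  exact h

end PBT

/-- The free dendriform algebra on one generator over `K`, with basis the planar binary trees. -/
def Dend (K : Type*) [CommRing K] : Type _ := PBT →₀ K

namespace Dend

variable {K : Type*} [CommRing K]

instance : AddCommGroup (Dend K) := inferInstanceAs (AddCommGroup (PBT →₀ K))

instance : Module K (Dend K) := inferInstanceAs (Module K (PBT →₀ K))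

variable (K) in
/-- The basis element given by a planar binary tree. -/
def tree (t : PBT) : Dend K := Finsupp.single t (1 : K)

variable (K) in
/-- The sum in `Dend` of a finite family of planar binary trees. -/
def sumTrees (m : Multiset PBT) : Dend K := (m.map (tree K)).sum

variable (K) in
/-- The bilinear map on `Dend` with given values on pairs of trees. -/
def bilin (f : PBT → PBT → Dend K) : Dend K →ₗ[K] Dend K →ₗ[K] Dend K :=
  Finsupp.linearCombination K fun t => (Finsupp.linearCombination K (f t) : Dend K →ₗ[K] Dend K)

variable (K) in
/-- The dendriform product `x ≺ y`. -/
def prec : Dend K →ₗ[K] Dend K →ₗ[K] Dend K := bilin K fun t s => sumTrees K (t.prec s)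

variable (K) in
/-- The dendriform product `x ≻ y`. -/
def succ : Dend K →ₗ[K] Dend K →ₗ[K] Dend K := bilin K fun t s => sumTrees K (t.succ s)

theorem bilin_tree (f : PBT → PBT → Dend K) (t s : PBT) :
    bilin K f (tree K t) (tree K s) = f t s := by
  unfold bilin tree
  erw [Finsupp.linearCombination_single, one_smul, Finsupp.linearCombination_single, one_smul]

theorem induction {p : Dend K → Prop} (zero : p 0) (add : ∀ x y, p x → p y → p (x + y))
    (smul : ∀ (c : K) t, p (c • tree K t)) (x : Dend K) : p x := by
  refine Finsupp.induction_linear (motive := p) x zero add fun t c => ?_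
  have h := smul c t
  unfold tree at h
  erw [Finsupp.smul_single, smul_eq_mul, mul_one] at h
  exact h

theorem bilin_sumTrees_left (f : PBT → PBT → Multiset PBT) (m : Multiset PBT) (s : PBT) :
    bilin K (fun t s => sumTrees K (f t s)) (sumTrees K m) (tree K s)
      = sumTrees K (m.bind fun t => f t s) := by
  induction m using Multiset.induction with
  | empty => simp [sumTrees]
  | cons a m ih =>
    simp only [sumTrees, Multiset.map_cons, Multiset.sum_cons, map_add, LinearMap.add_apply,
      Multiset.cons_bind, Multiset.map_add, Multiset.sum_add, bilin_tree] at ih ⊢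
    rw [ih]

theorem bilin_sumTrees_right (f : PBT → PBT → Multiset PBT) (t : PBT) (m : Multiset PBT) :
    bilin K (fun t s => sumTrees K (f t s)) (tree K t) (sumTrees K m)
      = sumTrees K (m.bind fun s => f t s) := by
  induction m using Multiset.induction with
  | empty => simp [sumTrees]
  | cons a m ih =>
    simp only [sumTrees, Multiset.map_cons, Multiset.sum_cons, map_add,
      Multiset.cons_bind, Multiset.map_add, Multiset.sum_add, bilin_tree] at ih ⊢
    rw [ih]

theorem sumTrees_add (m n : Multiset PBT) :
    sumTrees K (m + n) = sumTrees K m + sumTrees K n := by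
  simp [sumTrees]

/-- The first dendriform axiom. -/
theorem prec_prec (x y z : Dend K) :
    prec K x (prec K y z) + prec K x (succ K y z) = prec K (prec K x y) z := by
  induction x using Dend.induction with
  | zero => simp
  | add a b ha hb => simp only [map_add, LinearMap.add_apply, ← ha, ← hb]; abel
  | smul c t =>
    induction y using Dend.induction with
    | zero => simp
    | add a b ha hb => simp only [map_add, LinearMap.add_apply, ← ha, ← hb]; abel
    | smul e s =>
      induction z using Dend.induction with
      | zero => simp
      | add a b ha hb => simp only [map_add, ← ha, ← hb]; abel
      | smul g u =>
        simp only [map_smul, LinearMap.smul_apply, ← smul_add]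
        congr 3
        simp only [prec, succ, bilin_tree, bilin_sumTrees_left, bilin_sumTrees_right]
        rw [← sumTrees_add, ← Multiset.add_bind, PBT.prec_prec]

/-- The second dendriform axiom. -/
theorem succ_prec (x y z : Dend K) :
    succ K x (prec K y z) = prec K (succ K x y) z := by
  induction x using Dend.induction with
  | zero => simp
  | add a b ha hb => simp only [map_add, LinearMap.add_apply, ha, hb]
  | smul c t =>
    induction y using Dend.induction with
    | zero => simp
    | add a b ha hb => simp only [map_add, LinearMap.add_apply, ha, hb]
    | smul e s =>
      induction z using Dend.induction with
      | zero => simp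
      | add a b ha hb => simp only [map_add, ha, hb]
      | smul g u =>
        simp only [map_smul, LinearMap.smul_apply]
        congr 3
        simp only [prec, succ, bilin_tree, bilin_sumTrees_left, bilin_sumTrees_right]
        rw [PBT.succ_prec]

/-- The third dendriform axiom. -/
theorem succ_succ (x y z : Dend K) :
    succ K x (succ K y z) = succ K (succ K x y) z + succ K (prec K x y) z := by
  induction x using Dend.induction with
  | zero => simp
  | add a b ha hb => simp only [map_add, LinearMap.add_apply, ha, hb]; abel
  | smul c t =>
    induction y using Dend.induction with
    | zero => simp
    | add a b ha hb => simp only [map_add, LinearMap.add_apply, ha, hb]; abel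
    | smul e s =>
      induction z using Dend.induction with
      | zero => simp
      | add a b ha hb => simp only [map_add, ha, hb]; abel
      | smul g u =>
        simp only [map_smul, LinearMap.smul_apply, ← smul_add]
        congr 3
        simp only [prec, succ, bilin_tree, bilin_sumTrees_left, bilin_sumTrees_right]
        rw [← sumTrees_add, ← Multiset.add_bind, add_comm, PBT.succ_succ]

/-- The pre-Lie product `x ↶ y = y ≻ x - x ≺ y` of the dendriform algebra `Dend`. -/
instance : Mul (Dend K) where
  mul x y := succ K y x - prec K x y

theorem mul_def (x y : Dend K) : x * y = succ K y x - prec K x y := rfl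

instance : RightPreLieRing (Dend K) where
  left_distrib x y z := by simp only [mul_def, map_add, LinearMap.add_apply]; abel
  right_distrib x y z := by simp only [mul_def, map_add, LinearMap.add_apply]; abel
  zero_mul x := by simp [mul_def]
  mul_zero x := by simp [mul_def]
  assoc_symm' x y z := by
    change x * y * z - x * (y * z) = x * z * y - x * (z * y)
    simp only [mul_def, map_sub, LinearMap.sub_apply, succ_succ, ← prec_prec, succ_prec]
    abel

instance : RightPreLieAlgebra K (Dend K) where
  smul_assoc c x y := by
    simp only [smul_eq_mul, mul_def, map_smul, LinearMap.smul_apply, smul_sub]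
  smul_comm c x y := by
    simp only [smul_eq_mul, mul_def, map_smul, LinearMap.smul_apply, smul_sub]

end Dend

/-- The morphism `φ` of pre-Lie algebras from `PL` to `Dend` that maps the generator to the planar
binary tree with one vertex. -/
def phi (K : Type*) [CommRing K] : PL K →ₙₐ[K] Dend K :=
  FreePreLie.lift K fun _ => Dend.tree K ⟨.nil, .nil⟩

/-! ### `q`-analogues -/

/-- The `q`-integer `[n]_q = 1 + q + ⋯ + q ^ (n - 1)`. -/
def qInt {K : Type*} [Field K] (q : K) (n : ℕ) : K := ∑ i ∈ Finset.range n, q ^ i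

/-- The `q`-factorial `[n]_q! = [1]_q ⋯ [n]_q`. -/
def qFact {K : Type*} [Field K] (q : K) (n : ℕ) : K := ∏ i ∈ Finset.range n, qInt q (i + 1)

/-- The `q`-binomial coefficient `[n]_q! / ([k]_q! [n - k]_q!)` for `k ≤ n`. -/
def qBinom {K : Type*} [Field K] (q : K) (n k : ℕ) : K :=
  qFact q n / (qFact q k * qFact q (n - k))

end

/-! Put y = φ(Ω), f = φ(Ω_q), • for the one-vertex tree, and read all of them as functions on planar
binary trees. Let L and R be the operators z ↦ y ≻ z and z ↦ z ≺ y, and D = L - R the pre-Lie action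
of y. The dendriform axioms make L and R commute and turn powers of L and R into multiplication by
powers of y, so exp(R) exp(D) = exp(L). Hence g = z ↶ exp(y) satisfies g ≺ exp(y) = exp(y) ≻ z.

The series exp(y) is explicit. Expanding y^(m+1) in R^i D^j y (`pow_succ_eq_sum`) and summing gives
exp(y) - 1 = exp(R) ((exp(D) - 1)/D) y. The equation of Ω says ((exp(D) - 1)/D) y = •, so exp(y) = 1
+ • ≺ exp(y). The only solution is the sum C of the right combs (`comb_sub_partialExp_mem`,
`prec_comb_eq_succ_comb`).

Applying · ≺ C to the equation of Ω_q removes the exponential and leaves the linear equation C ≻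
f[q] + • ≺ (f * C) = f * C + (q - 1)(C - 1), used in `toSeries_eq_series`. Modulo higher degree it
reads (q^n - 1) f = known terms, so it has one solution without constant term (`eq_series`).

It remains to check that the claimed series solves it (`series_equation`). Its coefficients depend
only on the word of leaf orientations. Multiplying by C on the right sums over prefixes of this
word, and multiplying by C on the left sums over suffixes (`conv_comb`, `comb_conv`). The equation
thus becomes identities between sums over words. They follow from a closed form of the prefix sum
(`headSum_weight`) and from [m + n] = [m] + q^m [n]. -/

noncomputable section

/-! ### Functions on planar binary trees

A function on the possibly empty planar binary trees is a formal series of trees. -/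

/-- Formal series of possibly empty planar binary trees. -/
abbrev TreeSeries (K : Type*) : Type _ := BinaryTree Unit → K

namespace TreeSeries

variable {K : Type*} [Field K]

/-- The associative product `f * g` of two series. -/
def conv : TreeSeries K → TreeSeries K → TreeSeries K
  | f, g, .nil => f .nil * g .nil
  | f, g, .node _ l r =>
      conv f (fun b => g (.node () b r)) l + conv (fun a => f (.node () l a)) g r

/-- The dendriform product `f ≻ g` of two series. -/
def succ (f g : TreeSeries K) : TreeSeries K
  | .nil => 0
  | .node _ l r => conv f (fun b => g (.node () b r)) l

/-- The dendriform product `f ≺ g` of two series. -/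
def prec (f g : TreeSeries K) : TreeSeries K
  | .nil => 0
  | .node _ l r => conv (fun a => f (.node () l a)) g r

/-- The unit series: the empty tree. -/
def one : TreeSeries K
  | .nil => 1
  | .node _ _ _ => 0

/-- The tree with one vertex, as a series. -/
def dot : TreeSeries K
  | .nil => 0
  | .node _ .nil .nil => 1
  | .node _ _ _ => 0

/-- The sum of the right combs, including the empty tree. -/
def comb : TreeSeries K
  | .nil => 1
  | .node _ .nil r => comb r
  | .node _ _ _ => 0

theorem conv_nil (f g : TreeSeries K) : conv f g .nil = f .nil * g .nil := rfl

theorem conv_node (f g : TreeSeries K) (x : Unit) (l r : BinaryTree Unit) :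
    conv f g (.node x l r)
      = conv f (fun b => g (.node () b r)) l + conv (fun a => f (.node () l a)) g r := rfl

theorem conv_add_left (f f' g : TreeSeries K) (u : BinaryTree Unit) :
    conv (fun a => f a + f' a) g u = conv f g u + conv f' g u := by
  induction u generalizing f f' g with
  | nil => simp only [conv_nil, add_mul]
  | node x l r hl hr => rw [conv_node, hl, hr, conv_node, conv_node]; ring

theorem conv_add_right (f g g' : TreeSeries K) (u : BinaryTree Unit) :
    conv f (fun a => g a + g' a) u = conv f g u + conv f g' u := by
  induction u generalizing f g g' with
  | nil => simp only [conv_nil, mul_add]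
  | node x l r hl hr => rw [conv_node, hl, hr, conv_node, conv_node]; ring

theorem conv_smul_left (c : K) (f g : TreeSeries K) (u : BinaryTree Unit) :
    conv (fun a => c * f a) g u = c * conv f g u := by
  induction u generalizing f g with
  | nil => simp only [conv_nil, mul_assoc]
  | node x l r hl hr => rw [conv_node, hl, hr, conv_node]; ring

theorem conv_smul_right (c : K) (f g : TreeSeries K) (u : BinaryTree Unit) :
    conv f (fun a => c * g a) u = c * conv f g u := by
  induction u generalizing f g with
  | nil => simp only [conv_nil]; ring
  | node x l r hl hr => rw [conv_node, hl, hr, conv_node]; ring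

theorem conv_sub_left (f f' g : TreeSeries K) : conv (f - f') g = conv f g - conv f' g := by
  have h := conv_add_left (f - f') f' g
  simp only [Pi.sub_apply, sub_add_cancel] at h
  funext u
  exact eq_sub_of_add_eq (h u).symm

theorem conv_sub_right (f g g' : TreeSeries K) : conv f (g - g') = conv f g - conv f g' := by
  have h := conv_add_right f (g - g') g'
  simp only [Pi.sub_apply, sub_add_cancel] at h
  funext u
  exact eq_sub_of_add_eq (h u).symm

theorem conv_zero_left (g : TreeSeries K) (u : BinaryTree Unit) :
    conv (fun _ => 0) g u = 0 := by
  simpa using conv_smul_left 0 (fun _ => 0) g u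

theorem conv_zero_right (f : TreeSeries K) (u : BinaryTree Unit) :
    conv f (fun _ => 0) u = 0 := by
  simpa using conv_smul_right 0 f (fun _ => 0) u

/-- The two convolutions act on different variables of `G`, one through the left subtree and one
through the right, so their order is immaterial. -/
theorem conv_conv_comm (f h : TreeSeries K) (G : BinaryTree Unit → BinaryTree Unit → K)
    (l r : BinaryTree Unit) :
    conv (fun a => conv f (fun b => G b a) l) h r = conv f (fun b => conv (G b) h r) l := by
  induction l generalizing f G with
  | nil => simp only [conv_nil, conv_smul_left]
  | node x l m hl hm => simp only [conv_node, conv_add_left, hl, hm]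

/-- The root of a tree in a triple product comes from one of the three factors. Both bracketings
split into these three cases, the middle one being `conv_conv_comm`. -/
theorem conv_assoc (f g h : TreeSeries K) : conv (conv f g) h = conv f (conv g h) := by
  funext u
  induction u generalizing f g h with
  | nil => simp only [conv_nil, mul_assoc]
  | node x l r hl hr =>
    simp only [conv_node, conv_add_left, conv_add_right, conv_conv_comm]
    rw [hl, ← hr]
    ring

/-- With `prec_conv` and `succ_prec`, these are the dendriform axioms. As `conv` stands in them for
the sum of the two products, they hold for arbitrary constant terms. -/
theorem succ_conv (f g h : TreeSeries K) : succ (conv f g) h = succ f (succ g h) := by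
  funext u
  cases u with
  | nil => rfl
  | node x l r => simp only [succ, conv_assoc]

theorem prec_conv (f g h : TreeSeries K) : prec f (conv g h) = prec (prec f g) h := by
  funext u
  cases u with
  | nil => rfl
  | node x l r => simp only [prec, ← conv_assoc]

theorem succ_prec (f g h : TreeSeries K) : succ f (prec g h) = prec (succ f g) h := by
  funext u
  cases u with
  | nil => rfl
  | node x l r => simp only [prec, succ, conv_conv_comm]

theorem conv_one_left (g : TreeSeries K) : conv one g = g := by
  funext u
  induction u generalizing g with
  | nil => simp [conv_nil, one]
  | node x l r hl hr => simp only [conv_node, hl, one, conv_zero_left, add_zero]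

theorem conv_one_right (f : TreeSeries K) : conv f one = f := by
  funext u
  induction u generalizing f with
  | nil => simp [conv_nil, one]
  | node x l r hl hr => simp only [conv_node, hr, one, conv_zero_right, zero_add]

theorem one_succ {g : TreeSeries K} (hg : g .nil = 0) : succ one g = g := by
  funext u
  cases u with
  | nil => exact hg.symm
  | node x l r => simp only [succ, conv_one_left]

theorem prec_one {g : TreeSeries K} (hg : g .nil = 0) : prec g one = g := by
  funext u
  cases u with
  | nil => exact hg.symm
  | node x l r => simp only [prec, conv_one_right]

theorem succ_one (f : TreeSeries K) : succ f one = 0 := by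
  funext u
  cases u with
  | nil => rfl
  | node x l r => simp only [succ, one, conv_zero_right, Pi.zero_apply]

theorem conv_eq_succ_add_prec {f g : TreeSeries K} (h : f .nil * g .nil = 0) :
    conv f g = succ f g + prec f g := by
  funext u
  cases u with
  | nil => simpa [conv_nil, succ, prec] using h
  | node x l r => rfl

/-! ### The sum of the right combs -/

theorem dot_prec_node (f : TreeSeries K) (l r : BinaryTree Unit) :
    prec dot f (.node () l r) = one l * f r := by
  cases l with
  | nil =>
    have h : (fun a => dot (K := K) (.node () .nil a)) = one := by
      funext a; cases a <;> rfl
    simp only [prec, h, conv_one_left, one, one_mul]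
  | node x l m =>
    have h : (fun a => dot (K := K) (.node () (.node x l m) a)) = fun _ => 0 := by
      funext a; cases a <;> rfl
    simp only [prec, h, conv_zero_left, one, zero_mul]

theorem comb_node (l r : BinaryTree Unit) :
    comb (K := K) (.node () l r) = one l * comb r := by
  cases l <;> simp [comb, one]

/-- This fixed-point equation is how the right combs are recognised in the exponential of the Magnus
element. -/
theorem comb_eq : comb (K := K) = one + prec dot comb := by
  funext u
  cases u with
  | nil => simp [comb, one, prec]
  | node x l r => rw [Pi.add_apply, dot_prec_node, comb_node]; simp [one]

/-! ### Commuting multiplication operators and the powers of a series -/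

/-- Left multiplication `y ≻ ·`, as a linear map in both arguments. -/
def succHom : TreeSeries K →ₗ[K] TreeSeries K →ₗ[K] TreeSeries K :=
  LinearMap.mk₂ K succ
    (fun f f' g => by
      funext u; cases u <;> simp [succ]; exact conv_add_left _ _ _ _)
    (fun c f g => by
      funext u; cases u <;> simp [succ]; exact conv_smul_left _ _ _ _)
    (fun f g g' => by
      funext u; cases u <;> simp [succ]; exact conv_add_right _ _ _ _)
    (fun c f g => by
      funext u; cases u <;> simp [succ]; exact conv_smul_right _ _ _ _)

/-- The product `≺` with its arguments exchanged, as a linear map in both arguments. -/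
def precHom : TreeSeries K →ₗ[K] TreeSeries K →ₗ[K] TreeSeries K :=
  LinearMap.mk₂ K (fun y f => prec f y)
    (fun f f' g => by
      funext u; cases u <;> simp [prec]; exact conv_add_right _ _ _ _)
    (fun c f g => by
      funext u; cases u <;> simp [prec]; exact conv_smul_right _ _ _ _)
    (fun f g g' => by
      funext u; cases u <;> simp [prec]; exact conv_add_left _ _ _ _)
    (fun c f g => by
      funext u; cases u <;> simp [prec]; exact conv_smul_left _ _ _ _)

theorem succHom_apply (y f : TreeSeries K) : succHom y f = succ y f := rfl

theorem precHom_apply (y f : TreeSeries K) : precHom y f = prec f y := rfl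

/-- The pre-Lie action `· ↶ y`. -/
def graftHom (y : TreeSeries K) : Module.End K (TreeSeries K) := succHom y - precHom y

/-- This is the middle dendriform axiom. It makes the binomial theorem available for L = R + D. -/
theorem commute_succHom_precHom (y z : TreeSeries K) :
    Commute (succHom y : Module.End K (TreeSeries K)) (precHom z) := by
  ext1 f
  exact succ_prec y f z

theorem commute_precHom_graftHom (y : TreeSeries K) :
    Commute (precHom y : Module.End K (TreeSeries K)) (graftHom y) :=
  (commute_succHom_precHom y y).symm.sub_right (Commute.refl _)

theorem precHom_add_graftHom (y : TreeSeries K) :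
    (precHom y : Module.End K (TreeSeries K)) + graftHom y = succHom y :=
  add_sub_cancel _ _

/-- The powers of a series for the associative product. -/
def pow (y : TreeSeries K) : ℕ → TreeSeries K
  | 0 => one
  | m + 1 => conv (pow y m) y

theorem succHom_pow (y : TreeSeries K) (m : ℕ) {f : TreeSeries K} (hf : f .nil = 0) :
    ((succHom y : Module.End K (TreeSeries K)) ^ m) f = succ (pow y m) f := by
  induction m generalizing f with
  | zero => exact (one_succ hf).symm
  | succ m ih =>
    rw [pow_succ, Module.End.mul_apply, ih (by rfl), pow, succ_conv]
    rfl

theorem precHom_pow (y : TreeSeries K) (m : ℕ) {f : TreeSeries K} (hf : f .nil = 0) :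
    ((precHom y : Module.End K (TreeSeries K)) ^ m) f = prec f (pow y m) := by
  induction m with
  | zero => exact (prec_one hf).symm
  | succ m ih =>
    rw [pow_succ', Module.End.mul_apply, ih, pow, prec_conv]
    rfl

/-- Split y^(m+2) = y^(m+1) ≻ y + y^(m+1) ≺ y. The first term is L^(m+1) y = (R + D)^(m+1) y, the
second is R applied to the formula for y^(m+1), and Pascal's rule adds the coefficients. -/
theorem pow_succ_eq_sum {y : TreeSeries K} (hy : y .nil = 0) (m : ℕ) :
    pow y (m + 1) = ∑ p ∈ Finset.HasAntidiagonal.antidiagonal m, (m + 1).choose p.1 •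
      ((precHom y : Module.End K (TreeSeries K)) ^ p.1 * graftHom y ^ p.2) y := by
  induction m with
  | zero => simp [pow, conv_one_left]
  | succ m ih =>
    rw [pow, conv_eq_succ_add_prec (by rw [hy, mul_zero]), ← succHom_pow y (m + 1) hy,
      ← precHom_add_graftHom, (commute_precHom_graftHom y).add_pow', ← precHom_apply y, ih,
      LinearMap.sum_apply, Finset.Nat.sum_antidiagonal_succ, Finset.Nat.sum_antidiagonal_succ,
      add_assoc, map_sum]
    congr 1
    rw [← Finset.sum_add_distrib]
    refine Finset.sum_congr rfl fun p _ => ?_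
    rw [Nat.choose_succ_succ (m + 1) p.1, add_smul, add_comm, map_nsmul, LinearMap.smul_apply,
      pow_succ', mul_assoc]
    rfl

/-! ### The filtration by degree -/

variable (K) in
/-- The series without terms of degree less than `n`. -/
def filt (n : ℕ) : Submodule K (TreeSeries K) where
  carrier := {f | ∀ u, u.numNodes < n → f u = 0}
  add_mem' := fun hf hg u hu => by rw [Pi.add_apply, hf u hu, hg u hu, add_zero]
  zero_mem' := fun _ _ => rfl
  smul_mem' := fun c f hf u hu => by rw [Pi.smul_apply, hf u hu, smul_zero]

theorem filt_anti {m n : ℕ} (h : m ≤ n) : filt K n ≤ filt K m :=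
  fun _ hf u hu => hf u (hu.trans_le h)

theorem mem_filt_zero (f : TreeSeries K) : f ∈ filt K 0 :=
  fun _ hu => absurd hu (Nat.not_lt_zero _)

theorem mem_filt_one {f : TreeSeries K} : f ∈ filt K 1 ↔ f .nil = 0 := by
  refine ⟨fun h => h .nil Nat.zero_lt_one, fun h u hu => ?_⟩
  cases u with
  | nil => exact h
  | node x l r => simp at hu

theorem eq_of_forall_sub_mem_filt {f g : TreeSeries K} (h : ∀ n, f - g ∈ filt K n) : f = g := by
  funext u
  exact sub_eq_zero.mp (h (u.numNodes + 1) u (Nat.lt_succ_self _))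

theorem conv_eq_zero {m n : ℕ} {f g : TreeSeries K} (hf : f ∈ filt K m) (hg : g ∈ filt K n)
    (u : BinaryTree Unit) (hu : u.numNodes < m + n) : conv f g u = 0 := by
  induction u generalizing m n f g with
  | nil =>
    rw [conv_nil]
    rcases Nat.eq_zero_or_pos m with rfl | hm
    · rw [hg .nil (by simpa using hu), mul_zero]
    · rw [hf .nil (by simpa using hm), zero_mul]
  | node x l r hl hr =>
    simp only [BinaryTree.numNodes] at hu
    -- Fixing a root and one subtree lowers the order by their number of vertices. Truncated
    -- subtraction is harmless here, because every series has order at least 0.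
    rw [conv_node, hl (m := m) (n := n - (r.numNodes + 1)) hf _ (by omega),
      hr (m := m - (l.numNodes + 1)) (n := n) _ hg (by omega), add_zero]
    · intro a ha
      exact hf _ (by simp only [BinaryTree.numNodes]; omega)
    · intro a ha
      exact hg _ (by simp only [BinaryTree.numNodes]; omega)

theorem succ_mem_filt {m n : ℕ} {f g : TreeSeries K} (hf : f ∈ filt K m) (hg : g ∈ filt K n) :
    succ f g ∈ filt K (m + n) := by
  intro u hu
  cases u with
  | nil => rfl
  | node x l r =>
    simp only [BinaryTree.numNodes] at hu
    refine conv_eq_zero (n := n - (r.numNodes + 1)) hf (fun b hb => ?_) l (by omega)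
    exact hg _ (by simp only [BinaryTree.numNodes]; omega)

theorem prec_mem_filt {m n : ℕ} {f g : TreeSeries K} (hf : f ∈ filt K m) (hg : g ∈ filt K n) :
    prec f g ∈ filt K (m + n) := by
  intro u hu
  cases u with
  | nil => rfl
  | node x l r =>
    simp only [BinaryTree.numNodes] at hu
    refine conv_eq_zero (m := m - (l.numNodes + 1)) (fun b hb => ?_) hg r (by omega)
    exact hf _ (by simp only [BinaryTree.numNodes]; omega)

/-- An endomorphism that raises the degree. -/
def Raises (T : Module.End K (TreeSeries K)) : Prop :=
  ∀ n, ∀ f ∈ filt K n, T f ∈ filt K (n + 1)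

theorem raises_precHom {y : TreeSeries K} (hy : y .nil = 0) :
    Raises (precHom y : Module.End K (TreeSeries K)) :=
  fun _ _ hf => prec_mem_filt hf (mem_filt_one.mpr hy)

theorem raises_graftHom {y : TreeSeries K} (hy : y .nil = 0) : Raises (graftHom y) :=
  fun n _ hf => Submodule.sub_mem _
    (Nat.add_comm 1 n ▸ succ_mem_filt (mem_filt_one.mpr hy) hf)
    (prec_mem_filt hf (mem_filt_one.mpr hy))

theorem Raises.pow {T : Module.End K (TreeSeries K)} (hT : Raises T) (k : ℕ) {n : ℕ}
    {f : TreeSeries K} (hf : f ∈ filt K n) : (T ^ k) f ∈ filt K (k + n) := by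
  induction k with
  | zero => simpa using hf
  | succ k ih =>
    rw [pow_succ', Module.End.mul_apply]
    exact filt_anti (by omega) (hT _ _ ih)

theorem Raises.pow_mem {T : Module.End K (TreeSeries K)} (hT : Raises T) (k : ℕ) {n : ℕ}
    {f : TreeSeries K} (hf : f ∈ filt K n) : (T ^ k) f ∈ filt K n :=
  filt_anti (Nat.le_add_left _ _) (hT.pow k hf)

/-! ### Truncated power series in operators that raise the degree -/

/-- The partial sum `∑_{k < N} cₖ Tᵏ`. -/
def partialEval (N : ℕ) (c : ℕ → K) (T : Module.End K (TreeSeries K)) :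
    Module.End K (TreeSeries K) :=
  ∑ k ∈ Finset.range N, c k • T ^ k

theorem partialEval_apply (N : ℕ) (c : ℕ → K) (T : Module.End K (TreeSeries K))
    (f : TreeSeries K) : partialEval N c T f = ∑ k ∈ Finset.range N, c k • (T ^ k) f := by
  simp [partialEval]

theorem Raises.partialEval_mem {T : Module.End K (TreeSeries K)} (hT : Raises T) (N : ℕ)
    (c : ℕ → K) {n : ℕ} {f : TreeSeries K} (hf : f ∈ filt K n) :
    partialEval N c T f ∈ filt K n := by
  rw [partialEval_apply]
  exact Submodule.sum_mem _ fun k _ => Submodule.smul_mem _ _ (hT.pow_mem k hf)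

/-- The product of truncations and the truncation of the Cauchy product differ by terms S^i T^j with
i + j ≥ N, and these raise the degree by at least N. -/
theorem partialEval_partialEval_sub_mem {S T : Module.End K (TreeSeries K)} (hS : Raises S)
    (hT : Raises T) (N : ℕ) (c d : ℕ → K) (f : TreeSeries K) :
    partialEval N c S (partialEval N d T f) - ∑ m ∈ Finset.range N,
      ∑ p ∈ Finset.HasAntidiagonal.antidiagonal m, (c p.1 * d p.2) • (S ^ p.1 * T ^ p.2) f ∈ filt K N := by
  have h1 : partialEval N c S (partialEval N d T f) =
      ∑ p ∈ Finset.range N ×ˢ Finset.range N, (c p.1 * d p.2) • (S ^ p.1 * T ^ p.2) f := by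
    rw [partialEval_apply, Finset.sum_product]
    refine Finset.sum_congr rfl fun i _ => ?_
    rw [partialEval_apply, map_sum, Finset.smul_sum]
    refine Finset.sum_congr rfl fun j _ => ?_
    rw [map_smul, smul_smul, Module.End.mul_apply]
  have h2 : ∑ m ∈ Finset.range N,
      ∑ p ∈ Finset.HasAntidiagonal.antidiagonal m, (c p.1 * d p.2) • (S ^ p.1 * T ^ p.2) f =
      ∑ p ∈ (Finset.range N ×ˢ Finset.range N).filter (fun p => p.1 + p.2 < N),
        (c p.1 * d p.2) • (S ^ p.1 * T ^ p.2) f := by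
    rw [← Finset.sum_fiberwise_of_maps_to (s := (Finset.range N ×ˢ Finset.range N).filter _)
      (t := Finset.range N) (g := fun p => p.1 + p.2)
      (fun p hp => Finset.mem_range.mpr (Finset.mem_filter.mp hp).2)]
    refine Finset.sum_congr rfl fun m hm => Finset.sum_congr ?_ fun _ _ => rfl
    ext p
    simp only [Finset.HasAntidiagonal.mem_antidiagonal, Finset.mem_filter, Finset.mem_product, Finset.mem_range]
      at hm ⊢
    omega
  rw [h1, h2, ← Finset.sum_filter_add_sum_filter_not _ (fun p : ℕ × ℕ => p.1 + p.2 < N),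
    add_sub_cancel_left]
  refine Submodule.sum_mem _ fun p hp => Submodule.smul_mem _ _ ?_
  have hp := (Finset.mem_filter.mp hp).2
  exact filt_anti (by omega) (hS.pow p.1 (hT.pow p.2 (mem_filt_zero f)))

end TreeSeries


/-! ### The exponential of the Magnus element -/

namespace TreeSeries

variable {K : Type*} [Field K]

/-- The partial sums of the exponential `∑ₘ yᵐ / m!` for the associative product. -/
def partialExp (N : ℕ) (y : TreeSeries K) : TreeSeries K :=
  ∑ m ∈ Finset.range N, ((m.factorial : K)⁻¹) • pow y m

theorem pow_mem_filt {y : TreeSeries K} (hy : y .nil = 0) (m : ℕ) : pow y m ∈ filt K m := by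
  induction m with
  | zero => exact mem_filt_zero _
  | succ m ih => exact conv_eq_zero ih (mem_filt_one.mpr hy)

theorem partialEval_precHom (N : ℕ) (y : TreeSeries K) {f : TreeSeries K} (hf : f .nil = 0) :
    partialEval N (fun k => (k.factorial : K)⁻¹) (precHom y) f = prec f (partialExp N y) := by
  rw [partialEval_apply, ← precHom_apply, partialExp, map_sum, LinearMap.sum_apply]
  refine Finset.sum_congr rfl fun k _ => ?_
  rw [precHom_pow y k hf, map_smul]
  rfl

theorem partialEval_succHom (N : ℕ) (y : TreeSeries K) {f : TreeSeries K} (hf : f .nil = 0) :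
    partialEval N (fun k => (k.factorial : K)⁻¹) (succHom y) f = succ (partialExp N y) f := by
  rw [partialEval_apply, ← succHom_apply, partialExp, map_sum, LinearMap.sum_apply]
  refine Finset.sum_congr rfl fun k _ => ?_
  rw [succHom_pow y k hf, map_smul]
  rfl

theorem inv_factorial_mul_choose [CharZero K] {i j n : ℕ} (h : i + j = n) :
    (n.factorial : K)⁻¹ * (n.choose i : K) = (i.factorial : K)⁻¹ * (j.factorial : K)⁻¹ := by
  subst h
  have h1 : ((i + j).factorial : K) ≠ 0 := Nat.cast_ne_zero.mpr (Nat.factorial_ne_zero _)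
  have h2 : (i.factorial : K) ≠ 0 := Nat.cast_ne_zero.mpr (Nat.factorial_ne_zero _)
  have h3 : (j.factorial : K) ≠ 0 := Nat.cast_ne_zero.mpr (Nat.factorial_ne_zero _)
  have h := Nat.add_choose_mul_factorial_mul_factorial i j
  have h' : ((i + j).choose i : K) * i.factorial * j.factorial = (i + j).factorial := by
    rw [Nat.choose_symm_add]
    exact_mod_cast h
  rw [← h']
  have h4 : ((i + j).choose i : K) ≠ 0 := by
    intro h0
    rw [h0, zero_mul, zero_mul] at h'
    exact h1 h'.symm
  field_simp

/-- This is exp(R) exp(D) = exp(R + D) = exp(L) applied to f, modulo degree N, for the commuting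
operators R and D. -/
theorem exp_precHom_exp_graftHom_sub_mem [CharZero K] {y f : TreeSeries K} (hy : y .nil = 0)
    (hf : f .nil = 0) (N : ℕ) :
    prec (partialEval N (fun k => (k.factorial : K)⁻¹) (graftHom y) f) (partialExp N y)
      - succ (partialExp N y) f ∈ filt K N := by
  have h := partialEval_partialEval_sub_mem (raises_precHom hy) (raises_graftHom hy) N
    (fun k => (k.factorial : K)⁻¹) (fun k => (k.factorial : K)⁻¹) f
  have hD : partialEval N (fun k => (k.factorial : K)⁻¹) (graftHom y) f .nil = 0 :=
    mem_filt_one.mp ((raises_graftHom hy).partialEval_mem _ _ (mem_filt_one.mpr hf))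
  rw [partialEval_precHom N y hD] at h
  convert h using 2
  rw [← partialEval_succHom N y hf, partialEval_apply]
  refine Finset.sum_congr rfl fun m _ => ?_
  rw [← precHom_add_graftHom, (commute_precHom_graftHom y).add_pow', LinearMap.sum_apply,
    Finset.smul_sum]
  refine Finset.sum_congr rfl fun p hp => ?_
  rw [LinearMap.smul_apply, ← Nat.cast_smul_eq_nsmul K, smul_smul,
    inv_factorial_mul_choose (Finset.HasAntidiagonal.mem_antidiagonal.mp hp)]

variable (K) in
/-- The power series `(exp x - 1) / x`. -/
def expDiv : PowerSeries K := PowerSeries.mk fun k => ((k + 1).factorial : K)⁻¹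

theorem expDiv_mul_bernoulli [Algebra ℚ K] : expDiv K * bernoulliPowerSeries K = 1 := by
  have h : PowerSeries.exp K - 1 = expDiv K * PowerSeries.X := by
    ext n
    cases n with
    | zero => simp
    | succ n => simp [expDiv, PowerSeries.coeff_succ_mul_X, PowerSeries.coeff_exp,
        PowerSeries.coeff_one]
  have h' := bernoulliPowerSeries_mul_exp_sub_one K
  rw [h, ← mul_assoc] at h'
  rw [mul_comm]
  exact mul_right_cancel₀ PowerSeries.X_ne_zero (h'.trans (one_mul _).symm)

/-- Apply (exp(D) - 1)/D to y ≡ (D/(exp(D) - 1)) •. The two power series are inverse to each other,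
so only the constant term of their product survives. -/
theorem expDiv_graftHom_sub_mem [Algebra ℚ K] {y : TreeSeries K} (hy : y .nil = 0) {N : ℕ}
    (h : y - partialEval N (fun k => PowerSeries.coeff k (bernoulliPowerSeries K)) (graftHom y) dot
      ∈ filt K N) :
    partialEval N (fun k => PowerSeries.coeff k (expDiv K)) (graftHom y) y - dot ∈ filt K N := by
  rcases N with - | N
  · exact mem_filt_zero _
  have h1 := (raises_graftHom hy).partialEval_mem (N + 1)
    (fun k => PowerSeries.coeff k (expDiv K)) h
  have h2 := partialEval_partialEval_sub_mem (raises_graftHom hy) (raises_graftHom hy) (N + 1)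
    (fun k => PowerSeries.coeff k (expDiv K))
    (fun k => PowerSeries.coeff k (bernoulliPowerSeries K)) dot
  have h3 : ∑ m ∈ Finset.range (N + 1), ∑ p ∈ Finset.HasAntidiagonal.antidiagonal m,
      (PowerSeries.coeff p.1 (expDiv K) * PowerSeries.coeff p.2 (bernoulliPowerSeries K)) •
        (graftHom y ^ p.1 * graftHom y ^ p.2) dot = dot := by
    have h4 : ∀ m ∈ Finset.range (N + 1), ∑ p ∈ Finset.HasAntidiagonal.antidiagonal m,
        (PowerSeries.coeff p.1 (expDiv K) * PowerSeries.coeff p.2 (bernoulliPowerSeries K)) •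
          (graftHom y ^ p.1 * graftHom y ^ p.2) dot = if m = 0 then dot else 0 := by
      intro m _
      have h5 : ∀ p ∈ Finset.HasAntidiagonal.antidiagonal m,
          (PowerSeries.coeff p.1 (expDiv K) * PowerSeries.coeff p.2 (bernoulliPowerSeries K)) •
            (graftHom y ^ p.1 * graftHom y ^ p.2) dot =
          (PowerSeries.coeff p.1 (expDiv K) * PowerSeries.coeff p.2 (bernoulliPowerSeries K)) •
            (graftHom y ^ m) dot := by
        intro p hp
        rw [← pow_add, Finset.HasAntidiagonal.mem_antidiagonal.mp hp]
      rw [Finset.sum_congr rfl h5, ← Finset.sum_smul, ← PowerSeries.coeff_mul,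
        expDiv_mul_bernoulli, PowerSeries.coeff_one]
      split_ifs with hm
      · rw [hm, pow_zero, one_smul]; rfl
      · rw [zero_smul]
    rw [Finset.sum_congr rfl h4]
    simp
  rw [h3] at h2
  rw [map_sub] at h1
  simpa using Submodule.add_mem _ h1 h2

/-- Divide `pow_succ_eq_sum` by (m + 1)!. Since i + j = m, the quotient of the binomial coefficient
by (m + 1)! is 1/(i! (j + 1)!), which produces exp(R) and (exp(D) - 1)/D. -/
theorem sum_expDiv_eq [CharZero K] {y : TreeSeries K} (hy : y .nil = 0) (N : ℕ) :
    ∑ m ∈ Finset.range N, ∑ p ∈ Finset.HasAntidiagonal.antidiagonal m,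
      ((p.1.factorial : K)⁻¹ * PowerSeries.coeff p.2 (expDiv K)) •
        ((precHom y : Module.End K (TreeSeries K)) ^ p.1 * graftHom y ^ p.2) y
      = partialExp (N + 1) y - one := by
  rw [partialExp, Finset.sum_range_succ', pow, Nat.factorial_zero, Nat.cast_one, inv_one, one_smul,
    add_sub_cancel_right]
  refine Finset.sum_congr rfl fun m _ => ?_
  rw [pow_succ_eq_sum hy, Finset.smul_sum]
  refine Finset.sum_congr rfl fun p hp => ?_
  have hp := Finset.HasAntidiagonal.mem_antidiagonal.mp hp
  rw [← Nat.cast_smul_eq_nsmul K, smul_smul,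
    inv_factorial_mul_choose (show p.1 + (p.2 + 1) = m + 1 by omega), expDiv,
    PowerSeries.coeff_mk]

/-- The exponential of the solution `y` of `• ↶ (y / (exp y - 1)) = y` is the sum of the right
combs. -/
theorem comb_sub_partialExp_mem [Algebra ℚ K] {y : TreeSeries K} (hy : y .nil = 0) {N : ℕ}
    (h : y - partialEval N (fun k => PowerSeries.coeff k (bernoulliPowerSeries K)) (graftHom y) dot
      ∈ filt K N) :
    comb - partialExp N y ∈ filt K N := by
  have : CharZero K := algebraRat.charZero K
  have h1 := (raises_precHom hy).partialEval_mem N (fun k => (k.factorial : K)⁻¹)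
    (expDiv_graftHom_sub_mem hy h)
  have h2 := partialEval_partialEval_sub_mem (raises_precHom hy) (raises_graftHom hy) N
    (fun k => (k.factorial : K)⁻¹) (fun k => PowerSeries.coeff k (expDiv K)) y
  rw [map_sub, partialEval_precHom N y (f := dot) rfl] at h1
  rw [sum_expDiv_eq hy] at h2
  have h3 : partialExp (N + 1) y - partialExp N y ∈ filt K N := by
    rw [partialExp, Finset.sum_range_succ, ← partialExp, add_sub_cancel_left]
    exact Submodule.smul_mem _ _ (pow_mem_filt hy N)
  -- Both `comb` and the truncated exponential satisfy E = 1 + • ≺ E modulo degree N, so their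
  -- difference satisfies the homogeneous equation.
  have h4 : comb - partialExp N y - prec dot (comb - partialExp N y) ∈ filt K N := by
    have h5 := Submodule.sub_mem _ (Submodule.add_mem _ h3 h2) h1
    convert h5 using 1
    rw [← precHom_apply, map_sub, LinearMap.sub_apply, precHom_apply, precHom_apply]
    nth_rewrite 1 [comb_eq]
    abel
  -- As • ≺ · raises the degree, the homogeneous equation improves the order of the difference by
  -- one at a time.
  have h6 : ∀ n ≤ N, comb - partialExp N y ∈ filt K n := by
    intro n hn
    induction n with
    | zero => exact mem_filt_zero _
    | succ n ih =>
      have h7 := prec_mem_filt (mem_filt_one.mpr (show dot (K := K) .nil = 0 from rfl))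
        (ih (by omega))
      simpa using Submodule.add_mem _ (filt_anti hn h4) (filt_anti (by omega) h7)
  exact h6 N le_rfl

/-- If `y` solves `• ↶ (y / (exp y - 1)) = y` and `g = f ↶ exp y`, then `g ≺ C = C ≻ f` for the sum
`C` of the right combs. -/
theorem prec_comb_eq_succ_comb [Algebra ℚ K] {y f g : TreeSeries K} (hy : y .nil = 0)
    (hf : f .nil = 0)
    (h : ∀ N, y - partialEval N (fun k => PowerSeries.coeff k (bernoulliPowerSeries K))
      (graftHom y) dot ∈ filt K N)
    (hg : ∀ N, g - partialEval N (fun k => (k.factorial : K)⁻¹) (graftHom y) f ∈ filt K N) :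
    prec g comb = succ comb f := by
  have : CharZero K := algebraRat.charZero K
  refine eq_of_forall_sub_mem_filt fun N => ?_
  have h1 := comb_sub_partialExp_mem hy (h N)
  have h2 := exp_precHom_exp_graftHom_sub_mem hy hf N
  have h3 := prec_mem_filt (mem_filt_zero g) h1
  have h4 := prec_mem_filt (hg N) (mem_filt_zero (partialExp N y))
  have h5 := succ_mem_filt h1 (mem_filt_zero f)
  rw [zero_add] at h3
  rw [add_zero] at h4 h5
  rw [← precHom_apply] at h3 h4
  rw [← succHom_apply] at h5
  rw [map_sub, LinearMap.sub_apply] at h3 h5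
  rw [map_sub] at h4
  simp only [precHom_apply, succHom_apply] at h3 h4 h5
  have h6 := Submodule.sub_mem _ (Submodule.add_mem _ (Submodule.add_mem _ h3 h4) h2) h5
  convert h6 using 1
  abel

end TreeSeries


/-! ### Words of leaf orientations -/

namespace LeafWord

/-- The orientations of all leaves but the last one. -/
def word : BinaryTree Unit → List Bool
  | .nil => []
  | .node _ l r => PBT.leafSides l true ++ word r

theorem leafSides_false (u : BinaryTree Unit) : PBT.leafSides u false = word u ++ [false] := by
  induction u with
  | nil => rfl
  | node x l r hl hr => rw [PBT.leafSides, word, hr, List.append_assoc]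

theorem leafSides_node (x : Unit) (l r : BinaryTree Unit) (b : Bool) :
    PBT.leafSides (.node x l r) b = word (.node x l r) ++ [false] :=
  leafSides_false (.node x l r)

theorem exists_leafSides_true (u : BinaryTree Unit) :
    ∃ w, PBT.leafSides u true = true :: w := by
  induction u with
  | nil => exact ⟨[], rfl⟩
  | node x l r hl hr =>
    obtain ⟨w, hw⟩ := hl
    exact ⟨w ++ PBT.leafSides r false, by rw [PBT.leafSides, hw, List.cons_append]⟩

theorem exists_word_node (x : Unit) (l r : BinaryTree Unit) :
    ∃ w, word (.node x l r) = true :: w := by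
  obtain ⟨w, hw⟩ := exists_leafSides_true l
  exact ⟨w ++ word r, by rw [word, hw, List.cons_append]⟩

theorem length_leafSides (u : BinaryTree Unit) (b : Bool) :
    (PBT.leafSides u b).length = u.numNodes + 1 := by
  induction u generalizing b with
  | nil => rfl
  | node x l r hl hr =>
    rw [PBT.leafSides, List.length_append, hl, hr, BinaryTree.numNodes]
    omega

theorem length_word (u : BinaryTree Unit) : (word u).length = u.numNodes := by
  have h := length_leafSides u false
  rw [leafSides_false, List.length_append, List.length_singleton] at h
  omega

/-- The number of pairs consisting of a letter `false` and a later letter `true`. -/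
def inv : List Bool → ℕ
  | [] => 0
  | true :: w => inv w
  | false :: w => inv w + w.count true

theorem inv_append_true (w : List Bool) : inv (w ++ [true]) = inv w + w.count false := by
  induction w with
  | nil => rfl
  | cons x w ih => cases x <;> simp [inv, ih]; omega

theorem inv_append_false (w : List Bool) : inv (w ++ [false]) = inv w := by
  induction w with
  | nil => rfl
  | cons x w ih => cases x <;> simp [inv, ih]

theorem inv_eq_zero {w : List Bool} (h : false ∉ w) : inv w = 0 := by
  induction w with
  | nil => rfl
  | cons x w ih =>
    cases x with
    | false => simp at h
    | true => exact ih (by simpa using h)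

/-! ### Weights of words and sums over prefixes and suffixes -/

variable {K : Type*} [Field K]

theorem qInt_add (q : K) (m n : ℕ) : qInt q (m + n) = qInt q m + q ^ m * qInt q n := by
  simp only [qInt, Finset.sum_range_add, pow_add, Finset.mul_sum]

theorem qFact_succ (q : K) (n : ℕ) : qFact q (n + 1) = qFact q n * qInt q (n + 1) :=
  Finset.prod_range_succ _ _

theorem qFact_ne_zero {q : K} (hq : ∀ n, qInt q (n + 1) ≠ 0) (n : ℕ) : qFact q n ≠ 0 :=
  Finset.prod_ne_zero_iff.mpr fun i _ => hq i

/-- The coefficient attached to the word of the inner leaves. -/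
def weight (q : K) (w : List Bool) : K :=
  (-1) ^ w.count false * q ^ inv w * qFact q (w.count true) * qFact q (w.count false) /
    qFact q (w.count true + w.count false + 1)

/-- The coefficient attached to the word of all leaves but the last one. -/
def fullWeight (q : K) : List Bool → K
  | [] => 0
  | _ :: w => weight q w

/-- The sum of the values of `F` at `v` followed by an initial segment of a word, over those whose
complement has no letter `false` after its first letter. -/
def headSum (F : List Bool → K) : List Bool → List Bool → K
  | v, [] => F v
  | v, x :: w => F v * (if false ∈ w then 0 else 1) + headSum F (v ++ [x]) w

theorem headSum_append_true (F : List Bool → K) (v w : List Bool) :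
    headSum F v (w ++ [true]) = headSum F v w + F (v ++ (w ++ [true])) := by
  induction w generalizing v with
  | nil => simp [headSum]
  | cons x w ih =>
    rw [List.cons_append, headSum, ih, headSum]
    simp [add_assoc]

/-- A prefix ending strictly inside `w` leaves this `false` beyond the first letter of its
complement, so it does not contribute. -/
theorem headSum_append_false_cons (F : List Bool → K) (v w z : List Bool) :
    headSum F v (w ++ false :: z) =
      F (v ++ w) * (if false ∈ z then 0 else 1) + headSum F (v ++ (w ++ [false])) z := by
  induction w generalizing v with
  | nil => simp [headSum]
  | cons x w ih =>
    rw [List.cons_append, headSum, ih]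
    simp

theorem headSum_append_false (F : List Bool → K) (v w : List Bool) :
    headSum F v (w ++ [false]) = F (v ++ w) + F (v ++ (w ++ [false])) := by
  rw [headSum_append_false_cons]
  simp [headSum]

/-- The sum telescopes as the word grows at its end. Each step is a q-factorial identity resting on
[m + n] = [m] + q^m [n]. -/
theorem headSum_weight {q : K} (hq : ∀ n, qInt q (n + 1) ≠ 0) (w : List Bool) (g : ℕ)
    (hg : w.count false = g + 1) :
    headSum (fullWeight q) [true] w =
      (-1) ^ g * q ^ (inv w + g + 1) * qFact q (w.count true + 1) * qFact q g /
        qFact q (w.count true + g + 2) := by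
  induction w using List.reverseRecOn generalizing g with
  | nil => simp at hg
  | append_singleton w x ih =>
    cases x with
    | true =>
      have hg' : w.count false = g + 1 := by simpa using hg
      rw [headSum_append_true, ih g hg', inv_append_true, List.cons_append, List.nil_append,
        fullWeight, weight, inv_append_true]
      simp only [List.count_append, List.count_singleton_self, hg', List.count_singleton,
        Bool.true_beq, Bool.false_eq_true, if_false, add_zero]
      generalize w.count true = d
      generalize inv w = I
      have e1 := qFact_succ q (d + g + 2)
      have e2 := qFact_succ q (d + 1)
      have e3 := qFact_succ q g
      have e4 := qInt_add q (g + 1) (d + 2)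
      rw [show d + 1 + g + 2 = d + g + 2 + 1 by ring, show d + 1 + (g + 1) + 1 = d + g + 2 + 1 by ring,
        e1, e2, e3]
      rw [show g + 1 + (d + 2) = d + g + 2 + 1 by ring] at e4
      have n1 := hq (d + g + 2)
      have n2 := qFact_ne_zero hq (d + g + 2)
      rw [show d + 1 + 1 = d + 2 by ring]
      field_simp
      rw [e4]
      ring
    | false =>
      have hg' : w.count false = g := by simpa using hg
      -- After a final `false` only the last two prefixes count, so this case is computed directly
      -- without the induction hypothesis.
      rw [headSum_append_false, List.cons_append, List.nil_append, List.cons_append,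
        List.nil_append, fullWeight, fullWeight, weight, weight, inv_append_false]
      simp only [List.count_append, List.count_singleton_self, hg', List.count_singleton,
        Bool.false_beq, Bool.not_true, Bool.false_eq_true, if_false, add_zero]
      generalize w.count true = d
      generalize inv w = I
      have e1 := qFact_succ q (d + g + 1)
      have e2 := qFact_succ q d
      have e3 := qFact_succ q g
      have e4 := qInt_add q (g + 1) (d + 1)
      rw [show d + (g + 1) + 1 = d + g + 1 + 1 by ring, show d + g + 2 = d + g + 1 + 1 by ring,
        e1, e2, e3]
      rw [show g + 1 + (d + 1) = d + g + 1 + 1 by ring] at e4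
      have n1 := hq (d + g + 1)
      have n2 := qFact_ne_zero hq (d + g + 1)
      field_simp
      rw [e4]
      ring

/-- This is the transformed equation at a tree with empty left subtree and nonempty right subtree.
The term with q - 1 appears only at right combs. -/
theorem headSum_true_cons {q : K} (hq : ∀ n, qInt q (n + 1) ≠ 0) (w : List Bool) :
    q ^ (w.length + 2) * weight q (true :: w) + headSum (fullWeight q) [true] w =
      headSum (fullWeight q) [true] (true :: w) + (q - 1) * (if false ∈ w then 0 else 1) := by
  by_cases hw : false ∈ w
  · obtain ⟨g, hg⟩ := Nat.exists_eq_add_one.mpr (List.count_pos_iff.mpr hw)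
    have hl := List.count_true_add_count_false w
    rw [headSum_weight hq w g hg, headSum_weight hq (true :: w) g (by simpa using hg), weight,
      if_pos hw, ← hl]
    simp only [List.count_cons_self, hg, List.count_cons, inv, Bool.true_beq, Bool.false_eq_true,
      if_false, add_zero]
    generalize w.count true = d
    generalize inv w = I
    have e1 := qFact_succ q (d + g + 2)
    have e2 := qFact_succ q (d + 1)
    have e3 := qFact_succ q g
    have e4 := qInt_add q (d + 2) (g + 1)
    rw [show d + 1 + g + 2 = d + g + 2 + 1 by ring, show d + 1 + (g + 1) + 1 = d + g + 2 + 1 by ring,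
      e1, e2, e3]
    rw [show d + 2 + (g + 1) = d + g + 2 + 1 by ring] at e4
    have n1 := hq (d + g + 2)
    have n2 := qFact_ne_zero hq (d + g + 2)
    rw [show d + 1 + 1 = d + 2 by ring]
    field_simp
    rw [e4]
    ring
  -- The closed form needs a letter `false`. For m letters, all `true`, the weight of `true :: w` is
  -- 1/[m + 2], and the claim reduces to (q - 1)[m + 2] = q^(m+2) - 1.
  · have hw' : w = List.replicate w.length true := by
      refine List.eq_replicate_iff.mpr ⟨rfl, fun b hb => ?_⟩
      cases b with
      | false => exact absurd hb hw
      | true => rfl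
    have hw'' : true :: w = w ++ [true] := by
      rw [hw', ← List.replicate_succ, ← List.replicate_succ']
    have hc : w.count false = 0 := List.count_eq_zero.mpr hw
    have hd : w.count true = w.length := by
      have := List.count_true_add_count_false w
      omega
    have hwt : weight q (true :: w) * qInt q (w.length + 2) = 1 := by
      rw [weight, inv, inv_eq_zero hw]
      simp only [List.count_cons_self, hc, hd, List.count_cons, Bool.true_beq, Bool.false_eq_true,
        if_false, add_zero, pow_zero, one_mul]
      rw [qFact_succ q (w.length + 1), show qFact q 0 = 1 from Finset.prod_range_zero _]
      have n1 := hq (w.length + 1)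
      have n2 := qFact_ne_zero hq (w.length + 1)
      field_simp
    have h1 : headSum (fullWeight q) [true] (true :: w) =
        headSum (fullWeight q) [true] w + weight q (true :: w) := by
      conv_lhs => rw [hw'']
      rw [headSum_append_true, ← hw'']
      rfl
    have h2 : (q - 1) * qInt q (w.length + 2) = q ^ (w.length + 2) - 1 := by
      rw [mul_comm]
      exact geom_sum_mul q _
    rw [h1, if_neg hw]
    have n1 := hq (w.length + 1)
    refine mul_right_cancel₀ n1 ?_
    linear_combination (q ^ (w.length + 2) - 1) * hwt - h2

theorem headSum_false_cons {q : K} (hq : ∀ n, qInt q (n + 1) ≠ 0) (w : List Bool) :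
    q ^ (w.length + 2) * weight q (false :: w) + q ^ (w.length + 1) * weight q w =
      headSum (fullWeight q) [true] (false :: w) := by
  have hl := List.count_true_add_count_false w
  rw [headSum_weight hq (false :: w) (w.count false) (by simp), weight, weight, ← hl]
  simp only [List.count_cons_self, List.count_cons, inv, Bool.false_beq, Bool.not_true,
    Bool.false_eq_true, if_false, add_zero]
  generalize w.count true = d
  generalize w.count false = g
  generalize inv w = I
  have e1 := qFact_succ q (d + g + 1)
  have e2 := qFact_succ q d
  have e3 := qFact_succ q g
  have e4 := qInt_add q (d + 1) (g + 1)
  rw [show d + (g + 1) + 1 = d + g + 1 + 1 by ring, show d + g + 2 = d + g + 1 + 1 by ring,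
    e1, e2, e3]
  rw [show d + 1 + (g + 1) = d + g + 1 + 1 by ring] at e4
  have n1 := hq (d + g + 1)
  have n2 := qFact_ne_zero hq (d + g + 1)
  field_simp
  rw [e4]
  ring

/-- The sum of the values of `G` at the suffixes, with their first letter changed to `true`, up to
the first letter `false`. -/
def tailSum (G : List Bool → K) : List Bool → K
  | [] => 0
  | true :: w => G (true :: w) + tailSum G w
  | false :: w => G (true :: w)

/-- Each leading `true` shifts both sums by the same amount, by `headSum_true_cons`. At the first
`false` the suffix sum has just two terms, matched by `headSum_false_cons`. -/
theorem tailSum_eq_headSum {q : K} (hq : ∀ n, qInt q (n + 1) ≠ 0) {w : List Bool}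
    (hw : false ∈ w) :
    tailSum (fun v => q ^ v.length * fullWeight q v) (true :: w) =
      headSum (fullWeight q) [true] w := by
  induction w with
  | nil => simp at hw
  | cons x w ih =>
    rw [tailSum]
    cases x with
    | true =>
      have hw' : false ∈ w := by simpa using hw
      have h := headSum_true_cons hq w
      rw [if_pos hw', mul_zero, add_zero] at h
      rw [ih hw', ← h]
      rfl
    | false => exact headSum_false_cons hq w

/-! ### Products with the right combs, read on leaf words -/

open TreeSeries

theorem comb_eq_ite (u : BinaryTree Unit) :
    comb (K := K) u = if false ∈ word u then 0 else 1 := by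
  induction u with
  | nil => rfl
  | node x l r hl hr =>
    rw [comb_node, hr]
    cases l with
    | nil => simp [one, word, PBT.leafSides]
    | node y a b => simp [one, word, leafSides_node]

/-- If u occurs in a * c with c a right comb, the word of a is a prefix of that of u, and c
contributes only `true` after the first letter of the complement. The accumulator `v` records the
leaves passed on the way down the right spine. -/
theorem conv_comb (F : List Bool → K) (v : List Bool) (u : BinaryTree Unit) :
    conv (fun a => F (v ++ word a)) comb u = headSum F v (word u) := by
  induction u generalizing v with
  | nil => simp [conv_nil, word, comb, headSum]
  | node x l r hl hr =>
    have h1 : (fun b => comb (K := K) (.node () b r)) = fun b => comb r * one b := by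
      funext b; rw [comb_node, mul_comm]
    have h2 := hr (v ++ PBT.leafSides l true)
    simp only [List.append_assoc] at h2
    rw [conv_node, h1, conv_smul_right, conv_one_right]
    simp only [word]
    rw [h2, comb_eq_ite]
    cases l with
    | nil => simp [PBT.leafSides, word, headSum]
    | node y a b =>
      rw [leafSides_node, List.append_assoc, List.singleton_append, headSum_append_false_cons,
        mul_comm]

/-- If u occurs in c * b with c a right comb, the leaves of b form a suffix of those of u, except
that the first leaf of b is always a left child. The word `z` collects the leaves to the right of
the current subtree. For the empty tree the right side would go on into `z`, hence the restriction
to a node. -/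
theorem comb_conv (G : List Bool → K) (z : List Bool) (x : Unit) (l r : BinaryTree Unit) :
    conv comb (fun b => G (PBT.leafSides b true ++ z)) (.node x l r) =
      tailSum G (PBT.leafSides (.node x l r) true ++ z) := by
  generalize hu : BinaryTree.node x l r = u
  induction u generalizing x l r z with
  | nil => cases hu
  | node y a b ha hb =>
    have h1 : (fun c => comb (K := K) (.node () a c)) = fun c => one a * comb c := by
      funext c; rw [comb_node]
    rw [conv_node, h1, conv_smul_left]
    simp only [PBT.leafSides, List.append_assoc]
    cases a with
    | nil =>
      simp only [conv_nil, comb, one, one_mul, PBT.leafSides, List.singleton_append, tailSum]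
      congr 1
      cases b with
      | nil => simp [conv_nil, comb, PBT.leafSides, tailSum]
      | node y' c d => rw [hb z y' c d rfl, leafSides_node, leafSides_node]
    | node y' c d =>
      rw [ha (PBT.leafSides b false ++ z) y' c d rfl]
      simp [one]

/-- The series of planar binary trees with the coefficients `fullWeight`. -/
def series (q : K) : TreeSeries K := fun u => fullWeight q (word u)

/-- The transformed equation satisfied by `series`. -/
theorem series_equation {q : K} (hq : ∀ n, qInt q (n + 1) ≠ 0) :
    succ comb (fun u => q ^ u.numNodes * series q u) + prec dot (conv (series q) comb) =
      conv (series q) comb + (q - 1) • (comb - one) := by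
  have hP : ∀ u, conv (series q) comb u = headSum (fullWeight q) [] (word u) := fun u => by
    exact conv_comb (fullWeight q) [] u
  have hP' : ∀ u w, word u = true :: w →
      conv (series q) comb u = headSum (fullWeight q) [true] w := fun u w h => by
    rw [hP, h]; simp [headSum, fullWeight]
  funext u
  cases u with
  | nil => simp [succ, prec, conv_nil, series, word, fullWeight, comb, one]
  | node x l r =>
    have hA : (fun b => q ^ (BinaryTree.node () b r).numNodes * series q (.node () b r)) =
        fun b => (fun v => q ^ v.length * fullWeight q v) (PBT.leafSides b true ++ word r) := by
      funext b
      rw [← length_word]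
      rfl
    obtain ⟨w, hw⟩ := exists_word_node x l r
    simp only [Pi.add_apply, Pi.smul_apply, Pi.sub_apply, smul_eq_mul]
    rw [dot_prec_node, hP' _ w hw, comb_eq_ite, hw, succ, hA]
    cases l with
    | nil =>
      have hw' : word r = w := by simpa [word, PBT.leafSides] using hw
      rw [hw', conv_nil]
      cases r with
      | nil =>
        have : w = [] := hw'.symm
        subst this
        have n1 := hq 0
        simp [comb, one, PBT.leafSides, fullWeight, weight, inv, headSum, conv_nil, series, word,
          qFact, qInt]
      | node y a b =>
        obtain ⟨w', hr⟩ := exists_word_node y a b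
        rw [hP' _ w' hr]
        have hw'' : w = true :: w' := hw'.symm.trans hr
        subst hw''
        have h := headSum_true_cons hq w'
        simpa [comb, one, PBT.leafSides, fullWeight] using h
    | node y a b =>
      have hw' : PBT.leafSides (.node y a b) true ++ word r = true :: w := hw
      have hw'' : false ∈ w := by
        have : false ∈ true :: w := by rw [← hw', leafSides_node]; simp
        simpa using this
      -- With a nonempty left subtree, both • ≺ (f * C) and C - 1 vanish at the tree. Only the
      -- equality of the suffix sum and the prefix sum is left.
      rw [comb_conv fun v => q ^ v.length * fullWeight q v, hw', tailSum_eq_headSum hq hw'']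
      simp [one, hw'']

/-- The transformed equation has at most one solution. -/
theorem eq_series {q : K} (hq : ∀ n, qInt q (n + 1) ≠ 0) (hq1 : q ≠ 1) {f : TreeSeries K}
    (hf : f .nil = 0)
    (h : succ comb (fun u => q ^ u.numNodes * f u) + prec dot (conv f comb) =
      conv f comb + (q - 1) • (comb - one)) : f = series q := by
  have hs := series_equation hq
  set s := series q
  have hs0 : s .nil = 0 := rfl
  have hd0 : (f - s) .nil = 0 := by rw [Pi.sub_apply, hf, hs0, sub_zero]
  have hcomb : comb - one ∈ filt K 1 := mem_filt_one.mpr (by simp [comb, one])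
  have hshift : (fun u => q ^ u.numNodes * f u) - (fun u => q ^ u.numNodes * s u) =
      fun u => q ^ u.numNodes * (f - s) u := by
    funext u
    simp only [Pi.sub_apply, mul_sub]
  have hd : succ comb (fun u => q ^ u.numNodes * (f - s) u) + prec dot (conv (f - s) comb) =
      conv (f - s) comb := by
    rw [← hshift, conv_sub_left, ← succHom_apply, ← precHom_apply, map_sub, map_sub,
      LinearMap.sub_apply, succHom_apply, succHom_apply, precHom_apply, precHom_apply]
    calc _ = (succ comb (fun u => q ^ u.numNodes * f u) + prec dot (conv f comb)) -
        (succ comb (fun u => q ^ u.numNodes * s u) + prec dot (conv s comb)) := by abel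
      _ = _ := by rw [h, hs]; abel
  refine eq_of_forall_sub_mem_filt fun n => ?_
  induction n with
  | zero => exact mem_filt_zero _
  | succ n ih =>
    have ih' : (fun u => q ^ u.numNodes * (f - s) u) ∈ filt K n := fun u hu => by
      beta_reduce
      rw [ih u hu, mul_zero]
    -- Modulo degree n + 1 the factor C acts as the unit and • ≺ · vanishes, so the homogeneous
    -- equation becomes (q^m - 1)(f - s) = 0 at trees with m vertices.
    have h1 := succ_mem_filt hcomb ih'
    have h2 : conv (f - s) (comb - one) ∈ filt K (n + 1) := conv_eq_zero ih hcomb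
    have h3 := prec_mem_filt (mem_filt_one.mpr (show dot (K := K) .nil = 0 from rfl))
      (show conv (f - s) comb ∈ filt K n from conv_eq_zero (n := 0) ih (mem_filt_zero _))
    rw [Nat.add_comm] at h1 h3
    rw [← succHom_apply, map_sub, LinearMap.sub_apply, succHom_apply, succHom_apply,
      one_succ (by rw [hd0, mul_zero])] at h1
    rw [conv_sub_right, conv_one_right] at h2
    have h4 := Submodule.add_mem _ (Submodule.sub_mem _ h2 h1) (Submodule.neg_mem _ h3)
    intro u hu
    have h5 := h4 u hu
    have h6 := congrFun hd u
    simp only [Pi.add_apply, Pi.sub_apply, Pi.neg_apply] at h5 h6 ⊢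
    cases u with
    | nil => exact hd0
    | node x l r =>
      have h7 : (q ^ (BinaryTree.node x l r).numNodes - 1) * (f - s) (.node x l r) = 0 := by
        rw [Pi.sub_apply]
        linear_combination h5 + h6
      refine (mul_eq_zero.mp h7).resolve_left ?_
      rw [BinaryTree.numNodes, ← geom_sum_mul]
      exact mul_ne_zero (hq _) (sub_ne_zero.mpr hq1)

end LeafWord


/-! ### Descents and the major index -/

namespace LeafWord

/-- The positions of the letters `true` of a word, counted from `1`. -/
def positions (w : List Bool) : Finset ℕ :=
  (Finset.Ioo 0 (w.length + 1)).filter fun i => (true :: w)[i]? = some true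

theorem positions_append (w : List Bool) (x : Bool) :
    positions (w ++ [x]) =
      if x = true then insert (w.length + 1) (positions w) else positions w := by
  have h : ∀ i, (true :: (w ++ [x]))[i]? =
      if i < w.length + 1 then (true :: w)[i]? else [x][i - (w.length + 1)]? := by
    intro i
    rw [← List.cons_append, List.getElem?_append, List.length_cons]
  ext i
  rcases lt_trichotomy i (w.length + 1) with hi | rfl | hi
  · cases x <;>
      simp [positions, h, hi.ne, show i < w.length + 1 + 1 by omega, show i ≤ w.length by omega]
  · cases x <;> simp [positions, h]
  · cases x <;>
      simp [positions, h, hi.ne', hi.not_gt, show ¬ i < w.length + 1 + 1 by omega]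

theorem notMem_positions (w : List Bool) : w.length + 1 ∉ positions w := by
  simp [positions]

theorem card_positions (w : List Bool) : (positions w).card = w.count true := by
  induction w using List.reverseRecOn with
  | nil => rfl
  | append_singleton w x ih =>
    rw [positions_append]
    cases x with
    | true => rw [if_pos rfl, Finset.card_insert_of_notMem (notMem_positions w), ih]; simp
    | false => simpa using ih

/-- The k-th `true` stands at position k plus the number of earlier `false`. Summing gives a
triangular number and the inversions, so the exponent of q in the theorem is `inv`. -/
theorem sum_positions (w : List Bool) :
    ∑ i ∈ positions w, i = inv w + (w.count true + 1).choose 2 := by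
  induction w using List.reverseRecOn with
  | nil => rfl
  | append_singleton w x ih =>
    rw [positions_append]
    cases x with
    | true =>
      have hl := List.count_true_add_count_false w
      rw [if_pos rfl, Finset.sum_insert (notMem_positions w), ih, inv_append_true,
        List.count_append, List.count_singleton_self, Nat.choose_succ_succ' (w.count true + 1) 1,
        Nat.choose_one_right, one_add_one_eq_two]
      omega
    | false => simpa [inv_append_false] using ih

theorem leaves_eq (t : PBT) : t.leaves = word t.toTree ++ [false] := by
  rw [PBT.leaves, leafSides_false, ← List.append_assoc]
  rfl

theorem descents_eq {t : PBT} {w : List Bool} (h : word t.toTree = true :: w) :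
    t.descents = positions w := by
  have hd : t.deg = w.length + 1 := by rw [PBT.deg, ← length_word, h, List.length_cons]
  rw [PBT.descents, positions, hd]
  refine Finset.filter_congr fun i hi => ?_
  rw [leaves_eq, h, List.getElem?_append_left
    (by rw [List.length_cons]; exact (Finset.mem_Ioo.mp hi).2)]

variable {K : Type*} [Field K]

theorem series_toTree {q : K} (hq : ∀ n, qInt q (n + 1) ≠ 0) (hq0 : q ≠ 0) (t : PBT) :
    (-1) ^ (t.deg - 1) / qInt q t.deg * ((-1) ^ t.d * (qBinom q (t.deg - 1) t.d)⁻¹ *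
      q ^ ((t.maj : ℤ) - ((t.d + 1).choose 2 : ℤ))) = series q t.toTree := by
  obtain ⟨w, hw⟩ := exists_word_node () t.left t.right
  have hw : word t.toTree = true :: w := hw
  have hl := List.count_true_add_count_false w
  have hdeg : t.deg = w.length + 1 := by rw [PBT.deg, ← length_word, hw, List.length_cons]
  have hd : t.d = w.count true := by rw [PBT.d, descents_eq hw, card_positions]
  have hmaj : t.maj = inv w + (w.count true + 1).choose 2 := by
    rw [PBT.maj, descents_eq hw, sum_positions]
  rw [series, hw, fullWeight, weight, hd, hmaj, hdeg, ← hl]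
  push_cast
  rw [add_sub_cancel_right, zpow_natCast, qBinom, Nat.add_sub_cancel_left,
    qFact_succ q (w.count true + w.count false), pow_add]
  have n1 := hq (w.count true + w.count false)
  have n2 := qFact_ne_zero hq (w.count true + w.count false)
  have n3 := qFact_ne_zero hq (w.count true)
  have n4 := qFact_ne_zero hq (w.count false)
  -- Here n - 1 is the number of letters, so the sign (-1)^(n-1) (-1)^d is (-1) to the number of
  -- `false`.
  have n5 : ((-1 : K) ^ w.count true) * (-1) ^ w.count true = 1 := by
    rw [← mul_pow]; simp
  field_simp
  linear_combination n5

end LeafWord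

/-! ### Coefficients of elements of the free dendriform algebra -/

namespace Dend

variable {K : Type*} [Field K]

/-- The series of the coefficients of an element of `Dend`. -/
def coeffs : Dend K →ₗ[K] TreeSeries K where
  toFun x := fun u => match u with
    | .nil => 0
    | .node _ l r => (show PBT →₀ K from x) ⟨l, r⟩
  map_add' x y := by
    funext u
    cases u with
    | nil => simp
    | node a l r => rfl
  map_smul' c x := by
    funext u
    cases u with
    | nil => simp
    | node a l r => rfl

theorem coeffs_nil (x : Dend K) : coeffs x .nil = 0 := rfl

theorem coeffs_injective : Function.Injective (coeffs (K := K)) := by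
  intro x y h
  refine Finsupp.ext (f := x) (g := y) fun t => ?_
  exact congrFun h t.toTree

variable (K) in
/-- The indicator function of a tree. -/
def indicator (a : BinaryTree Unit) : TreeSeries K := fun u => if a = u then 1 else 0

theorem indicator_node (l r p m : BinaryTree Unit) (x y : Unit) :
    indicator K (.node x l r) (.node y p m) = indicator K l p * indicator K r m := by
  simp only [indicator, BinaryTree.node.injEq, true_and]
  split_ifs <;> simp_all

theorem indicator_nil : indicator K .nil = TreeSeries.one := by
  funext u
  cases u <;> simp [indicator, TreeSeries.one]

theorem coeffs_tree (t : PBT) : coeffs (tree K t) = indicator K t.toTree := by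
  funext u
  cases u with
  | nil => simp [coeffs_nil, indicator, PBT.toTree]
  | node x l r =>
    classical
    change (Finsupp.single t (1 : K)) ⟨l, r⟩ = _
    rw [Finsupp.single_apply]
    obtain ⟨a, b⟩ := t
    simp [indicator, PBT.toTree]

theorem coeffs_sumTrees (m : Multiset PBT) (u : BinaryTree Unit) :
    coeffs (sumTrees K m) u = (m.map fun t => indicator K t.toTree u).sum := by
  induction m using Multiset.induction with
  | empty => simp [sumTrees]
  | cons t m ih =>
    rw [sumTrees, Multiset.map_cons, Multiset.sum_cons, map_add, Pi.add_apply, ← sumTrees, ih,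
      coeffs_tree, Multiset.map_cons, Multiset.sum_cons]

-- Splitting by the factor that supplies the root is the recursion of both `conv` and `PBT.star`.
-- The series products therefore extend those of `Dend`.
open TreeSeries in
theorem conv_indicator (a b u : BinaryTree Unit) :
    conv (indicator K a) (indicator K b) u =
      ((PBT.star a b).map fun v => indicator K v u).sum := by
  match a, b with
  | .nil, b => simp [indicator_nil, conv_one_left, PBT.star_nil_left]
  | .node x l r, .nil => simp [indicator_nil, conv_one_right, PBT.star_nil_right]
  | .node () l r, .node () l' r' =>
    rw [PBT.star_node, Multiset.map_add, Multiset.sum_add, Multiset.map_map, Multiset.map_map]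
    cases u with
    | nil => simp [conv_nil, indicator]
    | node x p m =>
      have h1 := conv_indicator (.node () l r) l' p
      have h2 := conv_indicator r (.node () l' r') m
      have e : (fun b => indicator K l' b * indicator K r' m) =
        fun b => indicator K r' m * indicator K l' b := by funext b; ring
      simp only [conv_node, Function.comp_def, indicator_node, Multiset.sum_map_mul_left,
        Multiset.sum_map_mul_right]
      rw [conv_smul_left, e, conv_smul_right, h1, h2]
      ring
termination_by a.numNodes + b.numNodes
decreasing_by all_goals simp [BinaryTree.numNodes]; try omega

theorem coeffs_prec (x y : Dend K) :
    coeffs (prec K x y) = TreeSeries.prec (coeffs x) (coeffs y) := by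
  rw [← TreeSeries.precHom_apply]
  induction x using Dend.induction with
  | zero => simp
  | add a b ha hb => simp only [map_add, LinearMap.add_apply, ha, hb]
  | smul c t =>
    induction y using Dend.induction with
    | zero => simp
    | add a b ha hb => simp only [map_add, LinearMap.add_apply, ha, hb]
    | smul e s =>
      simp only [map_smul, LinearMap.smul_apply]
      rw [smul_comm]
      congr 2
      rw [prec, bilin_tree, coeffs_tree, coeffs_tree, TreeSeries.precHom_apply]
      funext u
      rw [coeffs_sumTrees, PBT.prec, Multiset.map_map]
      cases u with
      | nil => simp [indicator, TreeSeries.prec, PBT.toTree]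
      | node z p m =>
        simp only [TreeSeries.prec, Function.comp_def, PBT.toTree, indicator_node,
          Multiset.sum_map_mul_left]
        rw [TreeSeries.conv_smul_left, ← conv_indicator]

theorem coeffs_succ (x y : Dend K) :
    coeffs (succ K x y) = TreeSeries.succ (coeffs x) (coeffs y) := by
  rw [← TreeSeries.succHom_apply]
  induction x using Dend.induction with
  | zero => simp
  | add a b ha hb => simp only [map_add, LinearMap.add_apply, ha, hb]
  | smul c t =>
    induction y using Dend.induction with
    | zero => simp
    | add a b ha hb => simp only [map_add, ha, hb]
    | smul e s =>
      simp only [map_smul, LinearMap.smul_apply]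
      congr 2
      rw [succ, bilin_tree, coeffs_tree, coeffs_tree, TreeSeries.succHom_apply]
      funext u
      rw [coeffs_sumTrees, PBT.succ, Multiset.map_map]
      cases u with
      | nil => simp [indicator, TreeSeries.succ, PBT.toTree]
      | node z p m =>
        simp only [TreeSeries.succ, Function.comp_def, PBT.toTree, indicator_node,
          Multiset.sum_map_mul_right]
        simp only [mul_comm _ (indicator K s.right m)]
        rw [TreeSeries.conv_smul_right, ← conv_indicator]

theorem coeffs_mul (x y : Dend K) :
    coeffs (x * y) = TreeSeries.graftHom (coeffs y) (coeffs x) := by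
  rw [mul_def, map_sub, coeffs_succ, coeffs_prec]
  rfl

end Dend


/-! ### The completed free pre-Lie algebra: recursion on the degree -/

/-- The component n of the iterates of `F` from 0 no longer changes after n + 1 steps, and the
stable values form the fixed point. -/
theorem exists_fixedPoint_of_causal {M : ℕ → Type*} [∀ n, Zero (M n)]
    (F : (∀ n, M n) → ∀ n, M n)
    (hF : ∀ A B n, (∀ m < n, A m = B m) → F A n = F B n) :
    ∃ A, F A = A ∧ ∀ B, F B = B → B = A := by
  have hstable : ∀ n k l, n < k → n < l → (F^[k] 0) n = (F^[l] 0) n := by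
    intro n
    induction n using Nat.strong_induction_on with
    | _ n ih =>
      intro k l hk hl
      obtain ⟨k, rfl⟩ := Nat.exists_eq_add_one.mpr (Nat.zero_lt_of_lt hk)
      obtain ⟨l, rfl⟩ := Nat.exists_eq_add_one.mpr (Nat.zero_lt_of_lt hl)
      rw [Function.iterate_succ_apply', Function.iterate_succ_apply']
      exact hF _ _ _ fun m hm => ih m hm k l (by omega) (by omega)
  have huniq : ∀ A B, F A = A → F B = B → B = A := by
    intro A B hA hB
    funext n
    induction n using Nat.strong_induction_on with
    | _ n ih =>
      rw [← hA, ← hB]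
      exact hF _ _ _ ih
  have hfix : F (fun n => (F^[n + 1] 0) n) = fun n => (F^[n + 1] 0) n := by
    funext n
    rw [Function.iterate_succ_apply']
    exact hF _ _ _ fun m hm => hstable m _ _ (Nat.lt_succ_self m) hm
  exact ⟨_, hfix, fun B hB => huniq _ B hfix hB⟩

namespace PLHat

section

variable {R : Type*} [CommRing R]

theorem homog_zero : PL.homog R 0 = ⊥ := by
  rw [PL.homog, Submodule.span_eq_bot]
  rintro _ ⟨w, hw, rfl⟩
  exact absurd hw w.length_pos.ne'

theorem apply_zero (A : PLHat R) : (A 0 : PL R) = 0 := by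
  exact (Submodule.mem_bot R).mp (homog_zero.le (A 0).2)

theorem coe_graft (A B : PLHat R) (n : ℕ) :
    (graft A B n : PL R) =
      ∑ p ∈ Finset.HasAntidiagonal.antidiagonal n, (A p.1 : PL R) * (B p.2 : PL R) := rfl

/-- Degree 0 of the completion is zero, so both factors of a contributing product have degree less
than n. This makes the defining equations causal. -/
theorem graft_congr {A A' B B' : PLHat R} {n : ℕ} (hA : ∀ m < n, A m = A' m)
    (hB : ∀ m < n, B m = B' m) : graft A B n = graft A' B' n := by
  apply Subtype.ext
  rw [coe_graft, coe_graft]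
  refine Finset.sum_congr rfl fun p hp => ?_
  have hp := Finset.HasAntidiagonal.mem_antidiagonal.mp hp
  obtain ⟨i, j⟩ := p
  simp only at hp ⊢
  rcases Nat.eq_zero_or_pos i with rfl | hi
  · rw [apply_zero A, apply_zero A', zero_mul, zero_mul]
  rcases Nat.eq_zero_or_pos j with rfl | hj
  · rw [apply_zero B, apply_zero B', mul_zero, mul_zero]
  rw [hA i (by omega), hB j (by omega)]

theorem iterate_graft_congr {A A' T T' : PLHat R} {n : ℕ} (hA : ∀ m < n, A m = A' m)
    (hT : ∀ m < n, T m = T' m) (k : ℕ) :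
    ((fun B => graft B T)^[k + 1] A) n = ((fun B => graft B T')^[k + 1] A') n := by
  induction k generalizing n with
  | zero => exact graft_congr hA hT
  | succ k ih =>
    rw [Function.iterate_succ_apply', Function.iterate_succ_apply' _ _ A']
    exact graft_congr
      (fun m hm => ih (fun i hi => hA i (hi.trans hm)) fun i hi => hT i (hi.trans hm)) hT

theorem coe_act (A : PLHat R) (f : PowerSeries R) (T : PLHat R) (n : ℕ) :
    (act A f T n : PL R) = ∑ k ∈ Finset.range (n + 1),
      PowerSeries.coeff k f • (((fun B => graft B T)^[k] A) n : PL R) := by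
  rw [act, Submodule.coe_sum]
  rfl

end

theorem exists_isOmega : ∃ Ω : PLHat ℚ, IsOmega Ω ∧ ∀ Ω' : PLHat ℚ, IsOmega Ω' → Ω' = Ω := by
  refine exists_fixedPoint_of_causal (fun Ω => act (gen ℚ) (bernoulliPowerSeries ℚ) Ω) ?_
  intro A B n h
  refine Finset.sum_congr rfl fun k _ => ?_
  cases k with
  | zero => rfl
  | succ k => rw [iterate_graft_congr (fun _ _ => rfl) h]

/-! ### The series of the image in the dendriform algebra -/

open TreeSeries

section

variable {K : Type*} [Field K]

/-- For homogeneous families, the degrees p.1 and p.2 are forced by the trees they are evaluated at.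
The offsets i and j count the vertices set aside when the recursion enters a subtree. -/
theorem sum_conv_eq {F G : ℕ → TreeSeries K} {i j : ℕ}
    (hF : ∀ p a, a.numNodes + i ≠ p → F p a = 0) (hG : ∀ p a, a.numNodes + j ≠ p → G p a = 0)
    (u : BinaryTree Unit) {n : ℕ} (hn : u.numNodes + i + j = n) :
    ∑ p ∈ Finset.HasAntidiagonal.antidiagonal n, conv (F p.1) (G p.2) u =
      conv (fun a => F (a.numNodes + i) a) (fun b => G (b.numNodes + j) b) u := by
  induction u generalizing F G i j n with
  | nil =>
    simp only [BinaryTree.numNodes, zero_add] at hn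
    rw [Finset.sum_eq_single (i, j)]
    · simp [conv_nil]
    · intro p hp hne
      have hp := Finset.HasAntidiagonal.mem_antidiagonal.mp hp
      rw [conv_nil]
      by_cases h : i = p.1
      · rw [hG, mul_zero]
        rintro h'
        exact hne (Prod.ext h.symm (by simpa using h'.symm))
      · rw [hF, zero_mul]
        simpa using h
    · intro h
      exact absurd (Finset.HasAntidiagonal.mem_antidiagonal.mpr hn) h
  | node x l r hl hr =>
    simp only [BinaryTree.numNodes] at hn
    simp only [conv_node, Finset.sum_add_distrib]
    rw [hl (i := i) (j := r.numNodes + 1 + j) (G := fun p b => G p (.node () b r)) hF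
        (fun p a h => hG _ _ (by simp only [BinaryTree.numNodes]; omega)) (by omega),
      hr (i := l.numNodes + 1 + i) (j := j) (F := fun p a => F p (.node () l a))
        (fun p a h => hF _ _ (by simp only [BinaryTree.numNodes]; omega)) hG (by omega)]
    congr 2
    · funext b
      simp only [BinaryTree.numNodes]
      congr 1
      ring
    · funext a
      simp only [BinaryTree.numNodes]
      congr 1
      ring

theorem conv_eq_zero_of_homogeneous {f g : TreeSeries K} {i j m n : ℕ}
    (hf : ∀ a, a.numNodes + i ≠ m → f a = 0) (hg : ∀ a, a.numNodes + j ≠ n → g a = 0)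
    (u : BinaryTree Unit) (hu : u.numNodes + i + j ≠ m + n) : conv f g u = 0 := by
  induction u generalizing f g i j m n with
  | nil =>
    simp only [BinaryTree.numNodes, zero_add] at hu
    rw [conv_nil]
    by_cases h : i = m
    · rw [hg .nil (by simp only [BinaryTree.numNodes]; omega), mul_zero]
    · rw [hf .nil (by simp only [BinaryTree.numNodes]; omega), zero_mul]
  | node x l r hl hr =>
    simp only [BinaryTree.numNodes] at hu
    rw [conv_node, hl (i := i) (j := r.numNodes + 1 + j) (m := m) (n := n) hf
        (fun a h => hg _ (by simp only [BinaryTree.numNodes]; omega)) (by omega),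
      hr (i := l.numNodes + 1 + i) (j := j) (m := m) (n := n)
        (fun a h => hf _ (by simp only [BinaryTree.numNodes]; omega)) hg (by omega), add_zero]

theorem graftHom_eq_zero_of_homogeneous {f g : TreeSeries K} {m n : ℕ}
    (hf : ∀ a, a.numNodes ≠ m → f a = 0) (hg : ∀ a, a.numNodes ≠ n → g a = 0)
    (u : BinaryTree Unit) (hu : u.numNodes ≠ m + n) : graftHom g f u = 0 := by
  cases u with
  | nil => simp [graftHom, succHom_apply, precHom_apply, succ, prec]
  | node x l r =>
    simp only [BinaryTree.numNodes] at hu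
    change conv g (fun b => f (.node () b r)) l - conv (fun a => f (.node () l a)) g r = 0
    rw [conv_eq_zero_of_homogeneous (i := 0) (j := r.numNodes + 1) (m := n) (n := m) hg
        (fun a h => hf _ (by simp only [BinaryTree.numNodes]; omega)) l (by omega),
      conv_eq_zero_of_homogeneous (i := l.numNodes + 1) (j := 0) (m := m) (n := n)
        (fun a h => hf _ (by simp only [BinaryTree.numNodes]; omega)) hg r (by omega), sub_zero]

theorem coeffs_dot : Dend.coeffs (Dend.tree K ⟨.nil, .nil⟩) = dot := by
  rw [Dend.coeffs_tree]
  funext u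
  rcases u with - | ⟨x, - | ⟨y, a, b⟩, - | ⟨z, c, d⟩⟩ <;>
    simp [Dend.indicator, PBT.toTree, dot]

theorem coeffs_phi_eq_zero {n : ℕ} {x : PL K} (hx : x ∈ PL.homog K n) (u : BinaryTree Unit)
    (hu : u.numNodes ≠ n) : Dend.coeffs (phi K x) u = 0 := by
  induction hx using Submodule.span_induction with
  | zero => simp
  | add a b _ _ ha hb => rw [map_add, map_add, Pi.add_apply, ha, hb, add_zero]
  | smul c a _ ha => rw [map_smul, map_smul, Pi.smul_apply, ha, smul_zero]
  | mem a ha =>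
    obtain ⟨w, hw, rfl⟩ := ha
    simp only [Set.mem_ofPred_eq] at hw
    induction w generalizing n u with
    | ih1 x =>
      have h : phi K (FreeMagma.lift (FreePreLie.of K) (FreeMagma.of x)) =
        Dend.tree K ⟨.nil, .nil⟩ := FreePreLie.lift_of _ _
      have hw : 1 = n := hw
      subst hw
      erw [h, coeffs_dot]
      rcases u with - | ⟨x, - | ⟨y, a, b⟩, - | ⟨z, c, d⟩⟩ <;> simp [dot] at hu ⊢
    | ih2 v w hv hw' =>
      have hw : v.length + w.length = n := hw
      rw [map_mul, map_mul, Dend.coeffs_mul]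
      exact graftHom_eq_zero_of_homogeneous (fun a ha => hv a ha rfl) (fun a ha => hw' a ha rfl) u
        (by omega)

/-- The series of the coefficients of the image under `φ` of an element of the completion. -/
def toSeries : PLHat K →ₗ[K] TreeSeries K where
  toFun A := fun u => Dend.coeffs (phi K (A u.numNodes : PL K)) u
  map_add' A B := by
    funext u
    simp only [Pi.add_apply, Submodule.coe_add, map_add]
  map_smul' c A := by
    funext u
    simp only [Pi.smul_apply, Submodule.coe_smul, map_smul, RingHom.id_apply]

theorem toSeries_apply (A : PLHat K) (u : BinaryTree Unit) :
    toSeries A u = Dend.coeffs (phi K (A u.numNodes : PL K)) u := rfl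

theorem toSeries_nil (A : PLHat K) : toSeries A .nil = 0 := rfl

theorem toSeries_graft (A B : PLHat K) :
    toSeries (graft A B) = graftHom (toSeries B) (toSeries A) := by
  funext u
  rw [toSeries_apply, coe_graft, map_sum, map_sum, Finset.sum_apply]
  simp only [map_mul, Dend.coeffs_mul]
  cases u with
  | nil => simp [graftHom, succHom_apply, precHom_apply, succ, prec]
  | node x l r =>
    change ∑ p ∈ Finset.HasAntidiagonal.antidiagonal (BinaryTree.node x l r).numNodes,
      (conv (Dend.coeffs (phi K (B p.2 : PL K)))
          (fun b => Dend.coeffs (phi K (A p.1 : PL K)) (.node () b r)) l -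
        conv (fun a => Dend.coeffs (phi K (A p.1 : PL K)) (.node () l a))
          (Dend.coeffs (phi K (B p.2 : PL K))) r) =
      conv (toSeries B) (fun b => toSeries A (.node () b r)) l -
        conv (fun a => toSeries A (.node () l a)) (toSeries B) r
    rw [Finset.sum_sub_distrib]
    congr 1
    · rw [← Finset.Nat.sum_antidiagonal_swap]
      exact sum_conv_eq (i := 0) (j := r.numNodes + 1)
        (F := fun p => Dend.coeffs (phi K (B p : PL K)))
        (G := fun p b => Dend.coeffs (phi K (A p : PL K)) (.node () b r))
        (fun p a h => coeffs_phi_eq_zero (B p).2 a h)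
        (fun p a h => coeffs_phi_eq_zero (A p).2 _ (by simp only [BinaryTree.numNodes]; omega)) l
        (by simp only [BinaryTree.numNodes]; omega)
    · rw [sum_conv_eq (i := l.numNodes + 1) (j := 0)
        (F := fun p a => Dend.coeffs (phi K (A p : PL K)) (.node () l a))
        (G := fun p => Dend.coeffs (phi K (B p : PL K)))
        (fun p a h => coeffs_phi_eq_zero (A p).2 _ (by simp only [BinaryTree.numNodes]; omega))
        (fun p a h => coeffs_phi_eq_zero (B p).2 a h) r
        (by simp only [BinaryTree.numNodes]; omega)]
      congr 1
      funext a
      rw [toSeries_apply, BinaryTree.numNodes,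
        show a.numNodes + (l.numNodes + 1) = l.numNodes + a.numNodes + 1 by omega]

theorem toSeries_iterate (A T : PLHat K) (k : ℕ) :
    toSeries ((fun B => graft B T)^[k] A) = (graftHom (toSeries T) ^ k) (toSeries A) := by
  induction k with
  | zero => rfl
  | succ k ih =>
    rw [Function.iterate_succ_apply', toSeries_graft, ih, pow_succ', Module.End.mul_apply]

theorem toSeries_gen : toSeries (gen K) = dot := by
  funext u
  rw [toSeries_apply]
  by_cases hu : u.numNodes = 1
  · rw [hu, gen, Pi.single_eq_same, ← coeffs_dot, phi, FreePreLie.lift_of]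
  · rw [gen, Pi.single_eq_of_ne hu, ZeroMemClass.coe_zero, map_zero, map_zero]
    rcases u with - | ⟨x, - | ⟨y, a, b⟩, - | ⟨z, c, d⟩⟩ <;> simp [dot] at hu ⊢

theorem toSeries_qShift (q : K) (A : PLHat K) :
    toSeries (qShift q A) = fun u => q ^ u.numNodes * toSeries A u := by
  funext u
  rw [toSeries_apply, qShift, Submodule.coe_smul, map_smul, map_smul]
  rfl

/-- At a tree with m < N vertices the two sums stop at k = m and k = N - 1. The extra terms vanish
because the k-th power of the action raises the degree by k. -/
theorem toSeries_act_sub_mem (A T : PLHat K) (f : PowerSeries K) (N : ℕ) :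
    toSeries (act A f T) - partialEval N (fun k => PowerSeries.coeff k f)
      (graftHom (toSeries T)) (toSeries A) ∈ filt K N := by
  intro u hu
  rw [Pi.sub_apply, sub_eq_zero, toSeries_apply, coe_act, map_sum, map_sum, Finset.sum_apply,
    partialEval_apply, Finset.sum_apply]
  have h : ∀ k, Dend.coeffs (phi K (PowerSeries.coeff k f •
      (((fun B => graft B T)^[k] A) u.numNodes : PL K))) u =
      (PowerSeries.coeff k f • (graftHom (toSeries T) ^ k) (toSeries A)) u := by
    intro k
    rw [map_smul, map_smul, ← toSeries_iterate]
    rfl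
  simp only [h]
  refine Finset.sum_subset (Finset.range_mono hu) fun k _ hk => ?_
  have hk : u.numNodes < k := by simpa using hk
  rw [Pi.smul_apply, (raises_graftHom (toSeries_nil T)).pow k (mem_filt_zero _) u (by omega),
    smul_zero]

end

/-! ### The `q`-equation and extension of scalars -/

variable {K : Type*} [Field K] [Algebra ℚ K]

theorem exists_isOmegaQ {q : K} (hq : ∀ n, q ^ (n + 1) ≠ 1) (Ω : PLHat ℚ) :
    ∃ Ωq : PLHat K, IsOmegaQ q Ω Ωq ∧ ∀ Ωq' : PLHat K, IsOmegaQ q Ω Ωq' → Ωq' = Ωq := by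
  -- This is the equation in degree n solved for its top-degree part (q^n - 1) Ω_{q,n}. In degree 0
  -- the inverse takes its default value, which is harmless since that component is zero.
  set F : PLHat K → PLHat K := fun A n => (q ^ n - 1)⁻¹ • (graft (gen K) A n + (q - 1) • gen K n -
    act (qShift q A) (PowerSeries.exp K - 1) (extend K Ω) n) with hF
  have hiff : ∀ A, F A = A ↔ IsOmegaQ q Ω A := by
    intro A
    rw [IsOmegaQ, funext_iff, funext_iff]
    refine forall_congr' fun n => ?_
    rcases n with - | n
    · have : Subsingleton (PL.homog K 0) := by rw [homog_zero]; infer_instance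
      exact ⟨fun _ => Subsingleton.elim _ _, fun _ => Subsingleton.elim _ _⟩
    · simp only [hF, Pi.add_apply, Pi.sub_apply, Pi.smul_apply, qShift]
      have hn : q ^ (n + 1) - 1 ≠ 0 := sub_ne_zero.mpr (hq n)
      rw [inv_smul_eq_iff₀ hn, sub_smul (q ^ (n + 1)), one_smul, sub_eq_iff_eq_add, add_sub_assoc, eq_comm,
        add_comm (act _ _ _ _)]
  have h := exists_fixedPoint_of_causal F (by
    intro A B n h
    have h1 : graft (gen K) A n = graft (gen K) B n := graft_congr (fun _ _ => rfl) h
    have h2 : act (qShift q A) (PowerSeries.exp K - 1) (extend K Ω) n =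
        act (qShift q B) (PowerSeries.exp K - 1) (extend K Ω) n := by
      -- The term k = 0 drops out because exp x - 1 has no constant term. Every other term involves
      -- a product and sees only lower degrees.
      refine Finset.sum_congr rfl fun k _ => ?_
      cases k with
      | zero => simp
      | succ k =>
        rw [iterate_graft_congr (A' := qShift q B)
          (fun m hm => by rw [qShift, qShift, h m hm]) (fun _ _ => rfl)]
    simp only [hF, h1, h2])
  simpa only [hiff] using h

theorem rat_smul_eq (c : ℚ) (x : PL K) : c • x = algebraMap ℚ K c • x := by
  obtain ⟨z, rfl⟩ := Quot.mk_surjective x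
  exact congrArg (Quot.mk _) (algebraMap_smul K c z).symm

theorem extend_graft (A B : PLHat ℚ) :
    extend K (graft A B) = graft (extend K A) (extend K B) := by
  funext n
  apply Subtype.ext
  rw [coe_graft]
  change PL.extend K (graft A B n : PL ℚ) = _
  rw [coe_graft, map_sum]
  exact Finset.sum_congr rfl fun p _ => map_mul _ _ _

theorem extend_gen : extend K (gen ℚ) = gen K := by
  funext n
  apply Subtype.ext
  change PL.extend K (gen ℚ n : PL ℚ) = (gen K n : PL K)
  rcases eq_or_ne n 1 with rfl | hn
  · simp only [gen, Pi.single_eq_same]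
    exact FreePreLie.lift_of _ _
  · simp [gen, hn]

theorem extend_iterate (A T : PLHat ℚ) (k : ℕ) :
    extend K ((fun B => graft B T)^[k] A) = (fun B => graft B (extend K T))^[k] (extend K A) := by
  induction k with
  | zero => rfl
  | succ k ih =>
    rw [Function.iterate_succ_apply', Function.iterate_succ_apply', extend_graft, ih]

theorem act_bernoulli_extend {Ω : PLHat ℚ} (h : IsOmega Ω) :
    act (gen K) (bernoulliPowerSeries K) (extend K Ω) = extend K Ω := by
  funext n
  apply Subtype.ext
  have h1 : (extend K Ω n : PL K) =
      PL.extend K (act (gen ℚ) (bernoulliPowerSeries ℚ) Ω n : PL ℚ) := by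
    rw [show act (gen ℚ) (bernoulliPowerSeries ℚ) Ω = Ω from h]
    rfl
  rw [h1, coe_act, coe_act, map_sum]
  refine Finset.sum_congr rfl fun k _ => ?_
  rw [map_smul, rat_smul_eq, ← extend_gen, ← extend_iterate]
  simp only [bernoulliPowerSeries, PowerSeries.coeff_mk]
  rfl

theorem act_exp (A T : PLHat K) :
    act A (PowerSeries.exp K - 1) T + A = act A (PowerSeries.exp K) T := by
  funext n
  simp only [Pi.add_apply, act]
  rw [Finset.sum_range_succ', Finset.sum_range_succ' _ n]
  simp [PowerSeries.coeff_one]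

/-- The image in the dendriform algebra of the solution of the `q`-equation. -/
theorem toSeries_eq_series {q : K} (hq : ∀ n, qInt q (n + 1) ≠ 0) (hq1 : q ≠ 1) {Ω : PLHat ℚ}
    {Ωq : PLHat K} (hΩ : IsOmega Ω) (hΩq : IsOmegaQ q Ω Ωq) :
    toSeries Ωq = LeafWord.series q := by
  refine LeafWord.eq_series hq hq1 (toSeries_nil Ωq) ?_
  rw [IsOmegaQ, act_exp] at hΩq
  have h1 := congrArg toSeries hΩq
  rw [map_sub, map_add, map_smul, toSeries_gen, toSeries_graft, toSeries_gen] at h1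
  have h2 := prec_comb_eq_succ_comb (y := toSeries (extend K Ω)) (f := toSeries (qShift q Ωq))
    (g := toSeries (act (qShift q Ωq) (PowerSeries.exp K) (extend K Ω))) (toSeries_nil _)
    (toSeries_nil _)
    (fun N => by
      have h := toSeries_act_sub_mem (gen K) (extend K Ω) (bernoulliPowerSeries K) N
      rwa [act_bernoulli_extend hΩ, toSeries_gen] at h)
    (fun N => by
      have h := toSeries_act_sub_mem (qShift q Ωq) (extend K Ω) (PowerSeries.exp K) N
      simpa [PowerSeries.coeff_exp] using h)
  have h3 : prec dot comb = comb - one (K := K) := eq_sub_of_add_eq' comb_eq.symm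
  -- Apply · ≺ C. The exponential turns into C ≻ f[q], and (f ≻ • - • ≺ f) ≺ C = f ≻ (• ≺ C) - • ≺
  -- (f * C), with • ≺ C = C - 1 and f ≻ 1 = 0.
  have h4 := congrArg (precHom comb) h1
  have h5 : prec (toSeries Ωq) comb + succ (toSeries Ωq) comb = conv (toSeries Ωq) comb := by
    rw [conv_eq_succ_add_prec (by rw [toSeries_nil, zero_mul]), add_comm]
  have h6 : succ (toSeries Ωq) (comb - one) = succ (toSeries Ωq) comb := by
    rw [← succHom_apply, map_sub, succHom_apply, succHom_apply, succ_one, sub_zero]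
  rw [map_sub, map_add, map_smul, precHom_apply, precHom_apply, precHom_apply, precHom_apply, h2,
    h3, graftHom, LinearMap.sub_apply, succHom_apply, precHom_apply, ← precHom_apply comb (_ - _), map_sub,
    precHom_apply, precHom_apply, ← succ_prec, ← prec_conv, h3, h6] at h4
  rw [← toSeries_qShift, ← h5]
  rw [← h5] at h4
  rw [sub_eq_iff_eq_add] at h4
  rw [h4]
  abel

end PLHat

/-! ### The indeterminate q and the final comparison of coefficients -/

theorem RatFunc.X_pow_ne_one (n : ℕ) : (RatFunc.X : RatFunc ℚ) ^ (n + 1) ≠ 1 := by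
  intro h
  rw [← RatFunc.algebraMap_X, ← map_pow, ← map_one (algebraMap (Polynomial ℚ) (RatFunc ℚ))] at h
  have h' := congrArg Polynomial.natDegree (RatFunc.algebraMap_injective ℚ h)
  simp at h'

theorem qInt_ne_zero {K : Type*} [Field K] {q : K} (hq : ∀ n, q ^ (n + 1) ≠ 1) (n : ℕ) :
    qInt q (n + 1) ≠ 0 := by
  intro h
  have h' : qInt q (n + 1) * (q - 1) = q ^ (n + 1) - 1 := geom_sum_mul q (n + 1)
  rw [h, zero_mul] at h'
  exact hq n (sub_eq_zero.mp h'.symm)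

end

theorem mainTheorem2 :
    ∃ Ω : PLHat ℚ, (IsOmega Ω ∧ ∀ Ω' : PLHat ℚ, IsOmega Ω' → Ω' = Ω) ∧
    ∃ Ωq : PLHat (RatFunc ℚ),
      (IsOmegaQ RatFunc.X Ω Ωq ∧
        ∀ Ωq' : PLHat (RatFunc ℚ), IsOmegaQ RatFunc.X Ω Ωq' → Ωq' = Ωq) ∧
      ∀ n : ℕ, 1 ≤ n →
        phi (RatFunc ℚ) (Ωq n : PL (RatFunc ℚ)) =
          ((-1 : RatFunc ℚ) ^ (n - 1) / qInt RatFunc.X n) •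
            ∑ t ∈ PBT.ofDeg n,
              ((-1 : RatFunc ℚ) ^ t.d * (qBinom RatFunc.X (n - 1) t.d)⁻¹ *
                (RatFunc.X : RatFunc ℚ) ^ ((t.maj : ℤ) - ((t.d + 1).choose 2 : ℤ))) •
              Dend.tree (RatFunc ℚ) t := by
  obtain ⟨Ω, hΩ, hΩ'⟩ := PLHat.exists_isOmega
  obtain ⟨Ωq, hΩq, hΩq'⟩ := PLHat.exists_isOmegaQ RatFunc.X_pow_ne_one Ω
  refine ⟨Ω, ⟨hΩ, hΩ'⟩, Ωq, ⟨hΩq, hΩq'⟩, fun n _ => ?_⟩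
  have hq := qInt_ne_zero RatFunc.X_pow_ne_one
  have hq1 : (RatFunc.X : RatFunc ℚ) ≠ 1 := by simpa using RatFunc.X_pow_ne_one 0
  have hseries := PLHat.toSeries_eq_series hq hq1 hΩ hΩq
  apply Dend.coeffs_injective
  funext u
  rw [map_smul, map_sum, Pi.smul_apply, Finset.sum_apply]
  simp only [map_smul, Pi.smul_apply, Dend.coeffs_tree, smul_eq_mul]
  cases u with
  | nil => simp [Dend.coeffs_nil, Dend.indicator, PBT.toTree]
  | node x l r =>
    by_cases hu : (BinaryTree.node x l r).numNodes = n
    · have hdeg : PBT.deg ⟨l, r⟩ = n := hu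
      rw [Finset.sum_eq_single ⟨l, r⟩]
      · have h1 := congrFun hseries (.node x l r)
        have h2 := LeafWord.series_toTree hq RatFunc.X_ne_zero ⟨l, r⟩
        rw [PLHat.toSeries_apply, hu] at h1
        rw [hdeg] at h2
        rw [h1]
        simpa [Dend.indicator, PBT.toTree] using h2.symm
      · intro t _ ht
        have : t.toTree ≠ .node x l r := fun h => ht (PBT.toTree_injective h)
        simp [Dend.indicator, this]
      · intro h
        exact absurd (PBT.mem_ofDeg.mpr hdeg) h
    · rw [PLHat.coeffs_phi_eq_zero (Ωq n).2 _ hu, Finset.sum_eq_zero, mul_zero]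
      intro t ht
      have : t.toTree ≠ .node x l r := fun h => hu (by
        rw [← h]
        exact PBT.mem_ofDeg.mp ht)
      simp [Dend.indicator, this]
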